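/- Let $M$ be a connected smooth Riemannian manifold of dimension $2n>4$ with metric $g$ and Levi-Civita connection $\nabla$, and let $J$ be a smooth almost complex structure on $M$ with $g(JX,JY)=g(X,Y)$. Suppose that $M$ is nearly Kähler, i.e. $(\nabla_XJ)X=0$ for all vector fields $X$. Let $R$ be the curvature tensor; the sectional curvature of a 2-plane $\alpha\subset T_pM$ with orthonormal basis $\{x,y\}$ is $K(\alpha,p)=R(x,y,y,x)$, and $\alpha$ is called antiholomorphic if $J\alpha\perp\alpha$. Suppose that $M$ has pointwise constant antiholomorphic sectional curvature $\nu$, i.e. there is a function $\nu:M\to\mathbb{R}$ such that $K(\alpha,p)=\nu(p)$ for every $p\in M$ and every antiholomorphic 2-plane $\alpha\subset T_pM$. Then $\nu$ is constant on $M$. -/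

import Mathlib

open Bundle VectorField Module
open scoped Manifold ContDiff

noncomputable section

namespace AlmostHermitian

section LeviCivita

variable {E : Type*} [NormedAddCommGroup E] [NormedSpace ℝ E] [FiniteDimensional ℝ E]
  {H : Type*} [TopologicalSpace H] (I : ModelWithCorners ℝ E H)
  {M : Type*} [TopologicalSpace M] [ChartedSpace H M] [IsManifold I ∞ M]
  [RiemannianBundle (fun x : M => TangentSpace I x)]
  [IsContMDiffRiemannianBundle I ∞ E (fun x : M => TangentSpace I x)]

/-- The Koszul expression
`(X⟨Y,Z⟩ + Y⟨Z,X⟩ - Z⟨X,Y⟩ + ⟨[X,Y],Z⟩ - ⟨[Y,Z],X⟩ + ⟨[Z,X],Y⟩) / 2`, equal to `⟨∇_X Y, Z⟩`. -/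
def koszul (Y X Z : Π x : M, TangentSpace I x) (p : M) : ℝ :=
  (1 / 2 : ℝ) *
    ((d% (fun q => inner ℝ (Y q) (Z q)) p) (X p)
      + (d% (fun q => inner ℝ (Z q) (X q)) p) (Y p)
      - (d% (fun q => inner ℝ (X q) (Y q)) p) (Z p)
      + inner ℝ (mlieBracket I X Y p) (Z p)
      - inner ℝ (mlieBracket I Y Z p) (X p)
      + inner ℝ (mlieBracket I Z X p) (Y p))

variable {I}

set_option linter.unusedSectionVars false in
theorem mdifferentiableAt_inner {X Y : Π x : M, TangentSpace I x} {p : M}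
    (hX : MDiffAt (T% X) p) (hY : MDiffAt (T% Y) p) :
    MDiffAt (fun q => (inner ℝ (X q) (Y q) : ℝ)) p :=
  MDifferentiableAt.inner_bundle (IB := I) (F := E) (E := fun x : M => TangentSpace I x)
    (b := fun q => q) hX hY

theorem koszul_tensorial_left {Y Z : Π x : M, TangentSpace I x} {p : M}
    (hY : MDiffAt (T% Y) p) (hZ : MDiffAt (T% Z) p) :
    TensorialAt I E (fun X => koszul I Y X Z p) p where
  smul {f X} hf hX := by
    have h1 := mvfderiv_fun_mul hf (mdifferentiableAt_inner hZ hX)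
    have h2 := mvfderiv_fun_mul hf (mdifferentiableAt_inner hX hY)
    simp [koszul, inner_smul_left, inner_smul_right, inner_add_left, h1, h2,
      mlieBracket_smul_left hf hX, mlieBracket_smul_right hf hX]
    rw [real_inner_comm (X p) (Z p)]
    ring
  add {X X'} hX hX' := by
    have h1 := mvfderiv_fun_add (mdifferentiableAt_inner hZ hX) (mdifferentiableAt_inner hZ hX')
    have h2 := mvfderiv_fun_add (mdifferentiableAt_inner hX hY) (mdifferentiableAt_inner hX' hY)
    simp [koszul, inner_add_left, inner_add_right, h1, h2,
      mlieBracket_add_left hX hX', mlieBracket_add_right hX hX']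
    ring

theorem koszul_tensorial_right {Y X : Π x : M, TangentSpace I x} {p : M}
    (hY : MDiffAt (T% Y) p) (hX : MDiffAt (T% X) p) :
    TensorialAt I E (fun Z => koszul I Y X Z p) p where
  smul {f Z} hf hZ := by
    have h1 := mvfderiv_fun_mul hf (mdifferentiableAt_inner hY hZ)
    have h2 := mvfderiv_fun_mul hf (mdifferentiableAt_inner hZ hX)
    simp [koszul, inner_smul_left, inner_smul_right, inner_add_left, h1, h2,
      mlieBracket_smul_left hf hZ, mlieBracket_smul_right hf hZ]
    rw [real_inner_comm (Z p) (Y p)]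
    ring
  add {Z Z'} hZ hZ' := by
    have h1 := mvfderiv_fun_add (mdifferentiableAt_inner hY hZ) (mdifferentiableAt_inner hY hZ')
    have h2 := mvfderiv_fun_add (mdifferentiableAt_inner hZ hX) (mdifferentiableAt_inner hZ' hX)
    simp [koszul, inner_add_left, inner_add_right, h1, h2,
      mlieBracket_add_left hZ hZ', mlieBracket_add_right hZ hZ']
    ring

open Classical in
/-- The bilinear form `(x, z) ↦ ⟨∇_x Y, z⟩` on the tangent space at `p`. -/
def koszulForm (Y : Π x : M, TangentSpace I x) (p : M) :
    TangentSpace I p →L[ℝ] TangentSpace I p →L[ℝ] ℝ :=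
  if hY : MDiffAt (T% Y) p then
    TensorialAt.mkHom₂ (F := E) (F' := E) (fun X Z => koszul I Y X Z p) p
      (fun _ hZ => koszul_tensorial_left hY hZ) (fun _ hX => koszul_tensorial_right hY hX)
  else 0

theorem koszulForm_apply {Y X Z : Π x : M, TangentSpace I x} {p : M}
    (hY : MDiffAt (T% Y) p) (hX : MDiffAt (T% X) p) (hZ : MDiffAt (T% Z) p) :
    koszulForm Y p (X p) (Z p) = koszul I Y X Z p := by
  rw [koszulForm, dif_pos hY]
  exact TensorialAt.mkHom₂_apply _ _ hX hZ

instance (p : M) : FiniteDimensional ℝ (TangentSpace I p) :=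
  inferInstanceAs (FiniteDimensional ℝ E)

instance (p : M) : CompleteSpace (TangentSpace I p) := FiniteDimensional.complete ℝ _

/-- `∇ Y` at `p`, the endomorphism `x ↦ ∇_x Y` of the tangent space, which represents the
Koszul form with respect to the metric. -/
def leviCivitaFun (Y : Π x : M, TangentSpace I x) (p : M) :
    TangentSpace I p →L[ℝ] TangentSpace I p :=
  LinearMap.toContinuousLinearMap
    { toFun := fun x => (InnerProductSpace.toDual ℝ (TangentSpace I p)).symm (koszulForm Y p x)
      map_add' := fun x y => by simp
      map_smul' := fun c x => by simp }

theorem inner_leviCivitaFun (Y : Π x : M, TangentSpace I x) (p : M) (x z : TangentSpace I p) :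
    inner ℝ (leviCivitaFun Y p x) z = koszulForm Y p x z := by
  simp [leviCivitaFun]

theorem inner_leviCivitaFun_apply {Y X Z : Π x : M, TangentSpace I x} {p : M}
    (hY : MDiffAt (T% Y) p) (hX : MDiffAt (T% X) p) (hZ : MDiffAt (T% Z) p) :
    inner ℝ (leviCivitaFun Y p (X p)) (Z p) = koszul I Y X Z p := by
  rw [inner_leviCivitaFun, koszulForm_apply hY hX hZ]

set_option linter.unusedSectionVars false in
theorem exists_vectorField {p : M} (v : TangentSpace I p) :
    ∃ V : Π q : M, TangentSpace I q, MDiffAt (T% V) p ∧ V p = v :=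
  ⟨FiberBundle.extend E v, FiberBundle.mdifferentiableAt_extend .., by simp⟩

variable (I M) in
/-- The Levi-Civita connection of the Riemannian metric of `M`, given by the Koszul formula. -/
def leviCivita : CovariantDerivative I E (fun x : M => TangentSpace I x) where
  toFun := leviCivitaFun
  isCovariantDerivativeOnUniv :=
    { add := by
        intro Y Y' p hY hY' _
        ext x
        refine ext_inner_right ℝ fun z => ?_
        obtain ⟨X, hX, rfl⟩ := exists_vectorField x
        obtain ⟨Z, hZ, rfl⟩ := exists_vectorField z
        have h1 := mvfderiv_fun_add (mdifferentiableAt_inner hY hZ) (mdifferentiableAt_inner hY' hZ)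
        have h2 := mvfderiv_fun_add (mdifferentiableAt_inner hX hY) (mdifferentiableAt_inner hX hY')
        rw [inner_leviCivitaFun_apply (mdifferentiableAt_add_section hY hY') hX hZ,
          _root_.add_apply, inner_add_left, inner_leviCivitaFun_apply hY hX hZ,
          inner_leviCivitaFun_apply hY' hX hZ]
        simp [koszul, inner_add_left, inner_add_right, h1, h2,
          mlieBracket_add_left hY hY', mlieBracket_add_right hY hY']
        ring
      leibniz := by
        intro Y f p hY hf _
        ext x
        refine ext_inner_right ℝ fun z => ?_
        obtain ⟨X, hX, rfl⟩ := exists_vectorField x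
        obtain ⟨Z, hZ, rfl⟩ := exists_vectorField z
        have h1 := mvfderiv_fun_mul hf (mdifferentiableAt_inner hY hZ)
        have h2 := mvfderiv_fun_mul hf (mdifferentiableAt_inner hX hY)
        rw [inner_leviCivitaFun_apply (hf.smul_section hY) hX hZ]
        simp only [_root_.add_apply, _root_.smul_apply, inner_add_left,
          inner_smul_left, inner_leviCivitaFun_apply hY hX hZ,
          ContinuousLinearMap.smulRight_apply]
        simp [koszul, inner_smul_left, inner_smul_right, inner_add_left, h1, h2,
          mlieBracket_smul_left hf hY, mlieBracket_smul_right hf hY]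
        rw [real_inner_comm (Y p) (X p)]
        ring }

theorem leviCivita_torsion : (leviCivita I M).torsion = 0 := by
  rw [CovariantDerivative.torsion_eq_zero_iff]
  intro X Y p hX hY
  refine ext_inner_right ℝ fun z => ?_
  obtain ⟨Z, hZ, rfl⟩ := exists_vectorField z
  rw [inner_sub_left]
  change inner ℝ (leviCivitaFun Y p (X p)) (Z p) - inner ℝ (leviCivitaFun X p (Y p)) (Z p) = _
  rw [inner_leviCivitaFun_apply hY hX hZ, inner_leviCivitaFun_apply hX hY hZ]
  simp only [koszul, real_inner_comm, mlieBracket_swap_apply (V := Y) (W := X),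
    mlieBracket_swap_apply (V := Y) (W := Z), mlieBracket_swap_apply (V := Z) (W := X),
    inner_neg_left]
  ring

theorem leviCivita_metric {X Y Z : Π x : M, TangentSpace I x} {p : M}
    (hX : MDiffAt (T% X) p) (hY : MDiffAt (T% Y) p) (hZ : MDiffAt (T% Z) p) :
    (d% (fun q => (inner ℝ (Y q) (Z q) : ℝ)) p) (X p)
      = inner ℝ (leviCivita I M Y p (X p)) (Z p) + inner ℝ (Y p) (leviCivita I M Z p (X p)) := by
  change _ = inner ℝ (leviCivitaFun Y p (X p)) (Z p) + inner ℝ (Y p) (leviCivitaFun Z p (X p))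
  rw [real_inner_comm _ (Y p), inner_leviCivitaFun_apply hY hX hZ,
    inner_leviCivitaFun_apply hZ hX hY]
  simp only [koszul, real_inner_comm, mlieBracket_swap_apply (V := Y) (W := X),
    mlieBracket_swap_apply (V := Y) (W := Z), mlieBracket_swap_apply (V := Z) (W := X),
    inner_neg_left]
  ring

end LeviCivita

section Curvature

variable {E : Type*} [NormedAddCommGroup E] [NormedSpace ℝ E] [FiniteDimensional ℝ E]
  {H : Type*} [TopologicalSpace H] (I : ModelWithCorners ℝ E H)
  {M : Type*} [TopologicalSpace M] [ChartedSpace H M] [IsManifold I ∞ M]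
  [RiemannianBundle (fun x : M => TangentSpace I x)]
  [IsContMDiffRiemannianBundle I ∞ E (fun x : M => TangentSpace I x)]

/-- `R(X,Y)Z = ∇_X ∇_Y Z - ∇_Y ∇_X Z - ∇_{[X,Y]} Z`, for vector fields `X`, `Y`, `Z`. -/
def curvatureField (X Y Z : Π x : M, TangentSpace I x) (p : M) : TangentSpace I p :=
  leviCivita I M (fun q => leviCivita I M Z q (Y q)) p (X p)
    - leviCivita I M (fun q => leviCivita I M Z q (X q)) p (Y p)
    - leviCivita I M Z p (mlieBracket I X Y p)

/-- The curvature tensor `R(x,y,z,u) = ⟨R(x,y)z,u⟩` at `p`, where `x`, `y`, `z` are extended to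
vector fields that are smooth near `p` (constant in the preferred trivialization at `p`). -/
def curvature (p : M) (x y z u : TangentSpace I p) : ℝ :=
  inner ℝ (curvatureField I (FiberBundle.extend E x) (FiberBundle.extend E y)
    (FiberBundle.extend E z) p) u

/-- The plane `α` in the tangent space at `p` has sectional curvature `k`: for every orthonormal
basis `x`, `y` of `α`, `R(x,y,y,x) = k`. -/
def HasSectionalCurvature (p : M) (α : Submodule ℝ (TangentSpace I p)) (k : ℝ) : Prop :=
  ∀ x ∈ α, ∀ y ∈ α, ‖x‖ = 1 → ‖y‖ = 1 → (inner ℝ x y : ℝ) = 0 → curvature I p x y y x = k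

variable (M) in
/-- An almost Hermitian structure on the Riemannian manifold `M`: a smooth almost complex
structure `J` that is orthogonal for the metric. -/
structure AlmostHermitianStructure where
  /-- The almost complex structure. -/
  J : Π p : M, TangentSpace I p →L[ℝ] TangentSpace I p
  contMDiff_J : ContMDiff I (I.prod 𝓘(ℝ, E →L[ℝ] E)) ∞
    (fun p => TotalSpace.mk' (E →L[ℝ] E)
      (E := fun q : M => TangentSpace I q →L[ℝ] TangentSpace I q) p (J p))
  J_J : ∀ (p : M) (x : TangentSpace I p), J p (J p x) = -x
  inner_J_J : ∀ (p : M) (x y : TangentSpace I p), (inner ℝ (J p x) (J p y) : ℝ) = inner ℝ x y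

namespace AlmostHermitianStructure

variable {I}
variable (S : AlmostHermitianStructure I M)

/-- `(∇_X J) Y = ∇_X (J Y) - J (∇_X Y)`. -/
def covDerivJ (X Y : Π x : M, TangentSpace I x) (p : M) : TangentSpace I p :=
  leviCivita I M (fun q => S.J q (Y q)) p (X p) - S.J p (leviCivita I M Y p (X p))

/-- `M` is nearly Kähler: `(∇_X J) X = 0` for all (locally defined) smooth vector fields `X`. -/
def IsNearlyKahler : Prop :=
  ∀ (X : Π x : M, TangentSpace I x) (p : M), CMDiffAt ∞ (T% X) p → S.covDerivJ X X p = 0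

/-- A 2-plane `α` in the tangent space at `p` is antiholomorphic if `J α` is orthogonal to `α`. -/
def IsAntiholomorphic (p : M) (α : Submodule ℝ (TangentSpace I p)) : Prop :=
  finrank ℝ α = 2 ∧ ∀ x ∈ α, ∀ y ∈ α, (inner ℝ (S.J p x) y : ℝ) = 0

/-- `M` has pointwise constant antiholomorphic sectional curvature `ν`: at each point `p`, all
antiholomorphic planes have sectional curvature `ν p`. -/
def HasPointwiseConstantAntiholomorphicCurvature (ν : M → ℝ) : Prop :=
  ∀ (p : M) (α : Submodule ℝ (TangentSpace I p)),
    S.IsAntiholomorphic p α → HasSectionalCurvature I p α (ν p)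

end AlmostHermitianStructure

end Curvature

end AlmostHermitian

end

/-!
# Pointwise constant antiholomorphic sectional curvature on nearly Kähler manifolds

The proof is a variant of Schur's lemma that works with totally real orthonormal local fields
instead of an explicit formula for the curvature tensor `R`.

Fix a point `p` and a unit vector `w` there. As the dimension is at least six, `w` is part of an
orthonormal triple `w`, `x`, `y` such that `J` maps each of these vectors to a vector orthogonal to
all three. Rotating `y` inside the plane of `y` and `J y` one can moreover achieve
`R(Jy,y,y,x) = 0` (`exists_totallyReal_triple`), because this quantity is the restriction of a
linear form on that plane to its unit circle. The triple extends to smooth fields `W`, `X`, `Y` with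
the same orthogonality relations near `p` (`exists_totallyReal_fields`). Along these fields,
constancy of the antiholomorphic sectional curvature reads
`R(X,Y,Y,X) = ν` and, by polarization, `R(W,Y,Y,X) = R(W,X,X,Y) = 0`. Hence pairing the second
Bianchi identity for `W`, `X`, `Y`, applied to the field `Y`, with `X` expresses `dν(w)` as a sum of
values of `R` at `p` in which one argument is a covariant derivative such as `∇_w X` or `∇_x Y`.

Each of these values is computed by rotating antiholomorphic planes
(`curvature_outer_general`, `curvature_inner_general`): apart from multiples of `ν`, which cancel by
orthonormality, only multiples of `R(Jy,y,y,x) = 0`, `R(Jy,y,y,w)` and `R(Jx,x,x,w)` occur. The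
coefficient of `R(Jy,y,y,w)` is `⟨∇_x X, J y⟩ - ⟨∇_x Y, J x⟩ = ⟨(∇_x J) x, y⟩`, which vanishes on a
nearly Kähler manifold, and likewise for `R(Jx,x,x,w)` (`bianchi_correction_eq_zero`). So `dν = 0`
everywhere, and `ν` is constant on the connected manifold.

What remains is the standard theory of the Levi-Civita connection: smoothness of `∇_X Y`, by
expansion in a smooth local orthonormal frame; the symmetries of `R` and the Bianchi identities for
vector fields; and the fact that `R` is a tensor. The last is derived by tensoriality in the first
argument and the symmetries: skewness in the first two arguments gives the second one, and skewness
in the last two gives the third, in which the definition involves two derivatives.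
-/

open Filter Topology

noncomputable section

namespace AlmostHermitian

-- The sections below share the variables of the Riemannian setting, which some lemmas do not need.
set_option linter.unusedSectionVars false

/-! ### Curvature-like tensors with constant antiholomorphic sectional curvature -/

section Algebra

variable {V : Type*} [NormedAddCommGroup V] [InnerProductSpace ℝ V]

/-- `T` has the algebraic symmetries of a Riemannian curvature tensor `R(x,y,z,u)`. -/
structure IsCurvatureLike (T : V → V → V → V → ℝ) : Prop where
  add_first : ∀ x x' y z u, T (x + x') y z u = T x y z u + T x' y z u
  smul_first : ∀ (c : ℝ) x y z u, T (c • x) y z u = c * T x y z u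
  swap_first : ∀ x y z u, T y x z u = -T x y z u
  swap_last : ∀ x y z u, T x y u z = -T x y z u
  bianchi : ∀ x y z u, T x y z u + T y z x u + T z x y u = 0

namespace IsCurvatureLike

variable {T : V → V → V → V → ℝ} (hT : IsCurvatureLike T)
include hT

theorem pair_symm (x y z u : V) : T x y z u = T z u x y := by
  linarith [hT.bianchi x y z u, hT.bianchi y z u x, hT.bianchi z u x y, hT.bianchi u x y z,
    hT.swap_last y z x u, hT.swap_last z x y u, hT.swap_last u x y z, hT.swap_last x y z u,
    hT.swap_last z u x y, hT.swap_last u y z x, hT.swap_first u y z x, hT.swap_first u y x z,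
    hT.swap_first x z u y, hT.swap_last x z y u, hT.swap_first x z y u]

theorem add_second (x y y' z u : V) : T x (y + y') z u = T x y z u + T x y' z u := by
  rw [hT.swap_first, hT.add_first, hT.swap_first x y, hT.swap_first x y']; ring

theorem smul_second (c : ℝ) (x y z u : V) : T x (c • y) z u = c * T x y z u := by
  rw [hT.swap_first, hT.smul_first, hT.swap_first x y]; ring

theorem add_third (x y z z' u : V) : T x y (z + z') u = T x y z u + T x y z' u := by
  rw [hT.pair_symm, hT.add_first, hT.pair_symm z, hT.pair_symm z']

theorem smul_third (c : ℝ) (x y z u : V) : T x y (c • z) u = c * T x y z u := by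
  rw [hT.pair_symm, hT.smul_first, hT.pair_symm z]

theorem add_fourth (x y z u u' : V) : T x y z (u + u') = T x y z u + T x y z u' := by
  rw [hT.pair_symm, hT.add_second, hT.pair_symm z u, hT.pair_symm z u']

theorem smul_fourth (c : ℝ) (x y z u : V) : T x y z (c • u) = c * T x y z u := by
  rw [hT.pair_symm, hT.smul_second, hT.pair_symm z u]

theorem neg_first (x y z u : V) : T (-x) y z u = -T x y z u := by
  rw [← neg_one_smul ℝ x, hT.smul_first]; ring

theorem neg_second (x y z u : V) : T x (-y) z u = -T x y z u := by
  rw [← neg_one_smul ℝ y, hT.smul_second]; ring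

theorem self_first (x z u : V) : T x x z u = 0 := by
  linarith [hT.swap_first x x z u]

theorem self_last (x y z : V) : T x y z z = 0 := by
  linarith [hT.swap_last x y z z]

end IsCurvatureLike

/-- `y` is orthogonal to both `x` and `J x`. For nonzero `x`, `y` and orthogonal `J` this says that
`x`, `y` is an orthogonal basis of an antiholomorphic plane. -/
def IsTotallyReal (J : V →L[ℝ] V) (x y : V) : Prop :=
  inner ℝ x y = 0 ∧ inner ℝ (J x) y = 0

/-- `J` is an orthogonal complex structure on a Euclidean space. -/
structure IsOrthogonalComplex (J : V →L[ℝ] V) : Prop where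
  sq : ∀ x, J (J x) = -x
  inner_map : ∀ x y, inner ℝ (J x) (J y) = inner ℝ x y

namespace IsOrthogonalComplex

variable {J : V →L[ℝ] V} (hJ : IsOrthogonalComplex J)
include hJ

theorem inner_left (x y : V) : inner ℝ (J x) y = -inner ℝ x (J y) := by
  rw [← hJ.inner_map, hJ.sq, inner_neg_left]

theorem inner_self (x : V) : inner ℝ (J x) x = 0 := by
  have h := hJ.inner_left x x
  rw [real_inner_comm] at h ⊢
  linarith

theorem inner_self' (x : V) : inner ℝ x (J x) = 0 := by
  rw [real_inner_comm]; exact hJ.inner_self x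

theorem symm {x y : V} (h : IsTotallyReal J x y) : IsTotallyReal J y x :=
  ⟨by rw [real_inner_comm]; exact h.1, by
    have := h.2; rw [hJ.inner_left, real_inner_comm] at this; linarith⟩

theorem map_left {x y : V} (h : IsTotallyReal J x y) : IsTotallyReal J (J x) y :=
  ⟨h.2, by rw [hJ.sq, inner_neg_left, h.1, neg_zero]⟩

theorem map_right {x y : V} (h : IsTotallyReal J x y) : IsTotallyReal J x (J y) :=
  hJ.symm (hJ.map_left (hJ.symm h))

end IsOrthogonalComplex

section TotallyReal

variable {J : V →L[ℝ] V}

theorem IsTotallyReal.inner_map_right (hJ : IsOrthogonalComplex J) {x y : V}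
    (h : IsTotallyReal J x y) : inner ℝ x (J y) = 0 := (hJ.map_right h).1

theorem IsTotallyReal.add_left {x x' y : V} (h : IsTotallyReal J x y) (h' : IsTotallyReal J x' y) :
    IsTotallyReal J (x + x') y :=
  ⟨by rw [inner_add_left, h.1, h'.1, add_zero],
   by rw [map_add, inner_add_left, h.2, h'.2, add_zero]⟩

theorem IsTotallyReal.smul_left {x y : V} (c : ℝ) (h : IsTotallyReal J x y) :
    IsTotallyReal J (c • x) y :=
  ⟨by rw [real_inner_smul_left, h.1, mul_zero],
   by rw [map_smul, real_inner_smul_left, h.2, mul_zero]⟩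

theorem IsTotallyReal.add_right {x y y' : V} (h : IsTotallyReal J x y) (h' : IsTotallyReal J x y') :
    IsTotallyReal J x (y + y') :=
  ⟨by rw [inner_add_right, h.1, h'.1, add_zero], by rw [inner_add_right, h.2, h'.2, add_zero]⟩

theorem IsTotallyReal.smul_right {x y : V} (c : ℝ) (h : IsTotallyReal J x y) :
    IsTotallyReal J x (c • y) :=
  ⟨by rw [real_inner_smul_right, h.1, mul_zero], by rw [real_inner_smul_right, h.2, mul_zero]⟩

end TotallyReal

/-- All antiholomorphic planes have sectional curvature `k`, in homogeneous form. -/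
def HasConstantAntiholomorphic (J : V →L[ℝ] V) (T : V → V → V → V → ℝ) (k : ℝ) : Prop :=
  ∀ x y, IsTotallyReal J x y → T x y y x = k * (inner ℝ x x * inner ℝ y y)

section Constant

variable {J : V →L[ℝ] V} {T : V → V → V → V → ℝ} {k : ℝ}

section

variable (hT : IsCurvatureLike T) (hk : HasConstantAntiholomorphic J T k)
include hT hk

/-- Polarization of the constancy condition in the outer pair of arguments. -/
theorem curvature_outer {a x y : V} (ha : IsTotallyReal J a y) (hx : IsTotallyReal J x y) :
    T a y y x = k * (inner ℝ a x * inner ℝ y y) := by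
  have h1 := hk _ _ (ha.add_left hx)
  have h2 := hk _ _ ha
  have h3 := hk _ _ hx
  have h4 : T x y y a = T a y y x := by
    rw [hT.pair_symm, hT.swap_first, hT.swap_last]; ring
  simp only [hT.add_first, hT.add_fourth, inner_add_left, inner_add_right] at h1
  rw [real_inner_comm a x] at h1
  linarith

/-- Polarization in the inner pair of arguments. -/
theorem curvature_inner {w x y b : V} (hwx : inner ℝ w x = (0 : ℝ)) (hwy : IsTotallyReal J w y)
    (hxy : IsTotallyReal J x y) (hwb : IsTotallyReal J w b) (hxb : IsTotallyReal J x b) :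
    T w b y x + T w y b x = 0 := by
  have h1 := curvature_outer hT hk (hwy.add_right hwb) (hxy.add_right hxb)
  have h2 := curvature_outer hT hk hwy hxy
  have h3 := curvature_outer hT hk hwb hxb
  simp only [hT.add_second, hT.add_third, hwx] at h1 h2 h3
  linarith

end

variable (hJ : IsOrthogonalComplex J) (hT : IsCurvatureLike T)
  (hk : HasConstantAntiholomorphic J T k)
include hJ hT hk

/-- For a unit vector `y`, only the `J y`-component of `a` contributes beyond the constant
curvature term. -/
theorem curvature_outer_general {x y : V} (a : V) (hx : IsTotallyReal J x y)
    (hy : inner ℝ y y = (1 : ℝ)) :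
    T a y y x = k * inner ℝ a x + inner ℝ a (J y) * T (J y) y y x := by
  have hr : IsTotallyReal J (a + (-inner ℝ a y) • y + (-inner ℝ a (J y)) • J y) y := by
    constructor
    · simp only [inner_add_left, real_inner_smul_left, hy, hJ.inner_self]; ring
    · simp only [map_add, map_smul, inner_add_left, real_inner_smul_left, hJ.sq, inner_neg_left,
        hy, hJ.inner_self, hJ.inner_left a y]; ring
  have h := curvature_outer hT hk hr hx
  have h1 := (hJ.symm hx).1
  have h2 := (hJ.symm hx).2
  simp only [hT.add_first, hT.smul_first, hT.self_first, inner_add_left, real_inner_smul_left,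
    h1, h2, hy] at h
  linarith

/-- The function `h(x,y) = T(Jy,y,y,x)` is antisymmetric: differentiate the sectional curvature of
the antiholomorphic planes spanned by `x + t J y` and `y + t J x`. -/
theorem curvature_antisymm {x y : V} (hxy : IsTotallyReal J x y)
    (hx : inner ℝ x x = (1 : ℝ)) (hy : inner ℝ y y = (1 : ℝ)) :
    T (J x) x x y = -T (J y) y y x := by
  have hyx := hJ.symm hxy
  have hs := real_inner_comm x y
  have key (t : ℝ) : T (x + t • J y) (y + t • J x) (y + t • J x) (x + t • J y) =
      k * ((1 + t ^ 2) * (1 + t ^ 2)) := by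
    have h := hk (x + t • J y) (y + t • J x) ⟨by
      simp only [inner_add_left, inner_add_right, real_inner_smul_left, real_inner_smul_right,
        hJ.inner_self', hJ.inner_self, hJ.inner_map, hxy.1, hyx.1]; ring, by
      simp only [map_add, map_smul, inner_add_left, inner_add_right, real_inner_smul_left,
        real_inner_smul_right, hJ.sq, inner_neg_left, hJ.inner_map, hx, hy, hxy.2,
        hyx.inner_map_right hJ]; ring⟩
    rw [h]
    simp only [inner_add_left, inner_add_right, real_inner_smul_left, real_inner_smul_right,
      hJ.inner_map, hx, hy, hxy.2, hyx.2, hxy.inner_map_right hJ, hyx.inner_map_right hJ]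
    ring
  -- The values at `t = ±1, ±2` determine the coefficient of `t` of this polynomial of degree at most
  -- four.
  have h1 := key 1
  have h2 := key (-1)
  have h3 := key 2
  have h4 := key (-2)
  simp only [hT.add_first, hT.add_second, hT.add_third, hT.add_fourth, hT.smul_first,
    hT.smul_second, hT.smul_third, hT.smul_fourth] at h1 h2 h3 h4
  have e1 : T x y y (J y) = T (J y) y y x := by
    rw [hT.pair_symm, hT.swap_first, hT.swap_last]; ring
  have e2 : T x y (J x) x = T (J x) x x y := by
    rw [hT.pair_symm]
  have e3 : T x (J x) y x = T (J x) x x y := by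
    rw [hT.swap_first, hT.swap_last]; ring
  linarith

/-- Differentiate `T(w + t J y, y + t J w, y + t J w, x) = 0`, where the three arguments stay
totally real. -/
theorem curvature_rotate_left {w x y : V} (hwx : IsTotallyReal J w x) (hwy : IsTotallyReal J w y)
    (hxy : IsTotallyReal J x y) (hw : inner ℝ w w = (1 : ℝ)) (hy : inner ℝ y y = (1 : ℝ)) :
    T w (J w) y x + T w y (J w) x = -T (J y) y y x := by
  have hyw := hJ.symm hwy
  have key (t : ℝ) : T (w + t • J y) (y + t • J w) (y + t • J w) x = 0 := by
    rw [curvature_outer hT hk (x := x) ⟨by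
      simp only [inner_add_left, inner_add_right, real_inner_smul_left, real_inner_smul_right,
        hJ.inner_self', hJ.inner_self, hJ.inner_map, hwy.1, hyw.1]; ring, by
      simp only [map_add, map_smul, inner_add_left, inner_add_right, real_inner_smul_left,
        real_inner_smul_right, hJ.sq, inner_neg_left, hJ.inner_map, hw, hy, hwy.2,
        hyw.inner_map_right hJ]; ring⟩
      (hxy.add_right ((hJ.map_right (hJ.symm hwx)).smul_right t))]
    simp only [inner_add_left, real_inner_smul_left, hwx.1, (hJ.symm hxy).2]
    ring
  -- The values at `t = ±1, ±2` determine the coefficient of `t` of this polynomial of degree at most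
  -- four.
  have h1 := key 1
  have h2 := key (-1)
  have h3 := key 2
  have h4 := key (-2)
  simp only [hT.add_first, hT.add_second, hT.add_third, hT.smul_first,
    hT.smul_second, hT.smul_third] at h1 h2 h3 h4
  linarith

theorem curvature_rotate_right {w x y : V} (hwx : IsTotallyReal J w x) (hwy : IsTotallyReal J w y)
    (hxy : IsTotallyReal J x y) (hx : inner ℝ x x = (1 : ℝ)) (hy : inner ℝ y y = (1 : ℝ)) :
    T w (J x) y x + T w y (J x) x = -T (J y) y y w := by
  have h := curvature_rotate_left hJ hT hk (hJ.symm hwx) hxy hwy hx hy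
  have e1 : T x (J x) y w = T w y (J x) x := by
    rw [hT.pair_symm, hT.swap_first, hT.swap_last]; ring
  have e2 : T x y (J x) w = T w (J x) y x := by
    rw [hT.pair_symm, hT.swap_first, hT.swap_last]; ring
  linarith

/-- The inner polarization for a totally real orthonormal triple `w`, `x`, `y` and arbitrary `b`:
only the `J w`- and `J x`-components of `b` contribute. -/
theorem curvature_inner_general {w x y : V} (b : V) (hwx : IsTotallyReal J w x)
    (hwy : IsTotallyReal J w y) (hxy : IsTotallyReal J x y) (hw : inner ℝ w w = (1 : ℝ))
    (hx : inner ℝ x x = (1 : ℝ)) (hy : inner ℝ y y = (1 : ℝ)) :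
    T w b y x + T w y b x =
      -(inner ℝ b (J w) * T (J y) y y x) - inner ℝ b (J x) * T (J y) y y w := by
  have hxw := hJ.symm hwx
  set r : V := b + (-inner ℝ b w) • w + (-inner ℝ b (J w)) • J w + (-inner ℝ b x) • x
    + (-inner ℝ b (J x)) • J x with hr
  have c1 := real_inner_comm w b
  have c2 := real_inner_comm x b
  have c3 := real_inner_comm (J w) b
  have c4 := real_inner_comm (J x) b
  have hwr : IsTotallyReal J w r := by
    constructor <;>
    · simp only [hr, inner_add_right, real_inner_smul_right, hJ.inner_self, hJ.inner_self',
        hJ.inner_map, hw, hwx.1, hwx.2, hwx.inner_map_right hJ]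
      linarith
  have hxr : IsTotallyReal J x r := by
    constructor <;>
    · simp only [hr, inner_add_right, real_inner_smul_right, hJ.inner_self, hJ.inner_self',
        hJ.inner_map, hx, hxw.1, hxw.2, hxw.inner_map_right hJ]
      linarith
  have h := curvature_inner hT hk hwx.1 hwy hxy hwr hxr
  have h1 := curvature_rotate_left hJ hT hk hwx hwy hxy hw hy
  have h2 := curvature_rotate_right hJ hT hk hwx hwy hxy hx hy
  have h3 : T w y w x = 0 := by
    have := curvature_outer hT hk (hJ.symm hwy) (hJ.symm hwx)
    rw [(hJ.symm hxy).1] at this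
    rw [hT.swap_first]; linarith
  have h4 : T w x y x = 0 := by
    have := curvature_outer hT hk hwx (hJ.symm hxy)
    rw [hwy.1] at this
    rw [hT.swap_last]; linarith
  simp only [hr, hT.add_second, hT.add_third, hT.smul_second, hT.smul_third, hT.self_first,
    hT.self_last, h3, h4] at h
  linear_combination h + inner ℝ b (J w) * h1 + inner ℝ b (J x) * h2

end Constant

/-- In dimension at least six, every vector `w` is part of a totally real triple `w`, `x`, `y` with
unit vectors `x`, `y` and `T(Jy,y,y,x) = 0`: the expression is linear under rotation of `y` in the plane
of `y` and `J y`. -/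
theorem exists_totallyReal_triple [FiniteDimensional ℝ V] (hdim : 6 ≤ finrank ℝ V)
    {J : V →L[ℝ] V} {T : V → V → V → V → ℝ}
    (hJ : IsOrthogonalComplex J) (hT : IsCurvatureLike T) (w : V) :
    ∃ x y : V, IsTotallyReal J w x ∧ IsTotallyReal J w y ∧ IsTotallyReal J x y ∧
      inner ℝ x x = (1 : ℝ) ∧ inner ℝ y y = (1 : ℝ) ∧ T (J y) y y x = 0 := by
  classical
  have aux (s : Finset V) (hs : s.card < 6) :
      ∃ x : V, (∀ v ∈ s, inner ℝ v x = (0 : ℝ)) ∧ inner ℝ x x = (1 : ℝ) := by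
    have hlt : finrank ℝ (Submodule.span ℝ (s : Set V)) < finrank ℝ V :=
      ((finrank_span_finset_le_card s).trans_lt hs).trans_le hdim
    have hne : (Submodule.span ℝ (s : Set V))ᗮ ≠ ⊥ := by
      intro h
      rw [Submodule.orthogonal_eq_bot_iff] at h
      rw [h, finrank_top] at hlt
      exact lt_irrefl _ hlt
    obtain ⟨z, hz, hz0⟩ := Submodule.exists_mem_ne_zero_of_ne_bot hne
    refine ⟨(‖z‖⁻¹ : ℝ) • z, fun v hv => ?_, ?_⟩
    · rw [real_inner_smul_right, hz v (Submodule.subset_span hv), mul_zero]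
    · have : ‖z‖ ≠ 0 := norm_ne_zero_iff.mpr hz0
      rw [real_inner_smul_left, real_inner_smul_right, real_inner_self_eq_norm_sq]
      field_simp
  obtain ⟨x, hx, hx1⟩ := aux {w, J w} (Finset.card_le_two.trans_lt (by norm_num))
  obtain ⟨y, hy, hy1⟩ := aux {w, J w, x, J x} (Finset.card_le_four.trans_lt (by norm_num))
  simp only [Finset.mem_insert, Finset.mem_singleton, forall_eq_or_imp, forall_eq] at hx hy
  have hwy : IsTotallyReal J w y := ⟨hy.1, hy.2.1⟩
  have hxy : IsTotallyReal J x y := ⟨hy.2.2.1, hy.2.2.2⟩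
  obtain ⟨c, s, hcs, hcs'⟩ : ∃ c s : ℝ, c ^ 2 + s ^ 2 = 1 ∧
      c * T (J y) y y x + s * T (J y) y (J y) x = 0 := by
    set a := T (J y) y y x
    set b := T (J y) y (J y) x
    by_cases h : a ^ 2 + b ^ 2 = 0
    · have ha : a = 0 := by nlinarith [sq_nonneg a, sq_nonneg b]
      have hb : b = 0 := by nlinarith [sq_nonneg a, sq_nonneg b]
      exact ⟨1, 0, by norm_num, by rw [ha, hb]; norm_num⟩
    · have hpos : 0 < a ^ 2 + b ^ 2 := lt_of_le_of_ne (by positivity) (Ne.symm h)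
      have hsq := Real.sq_sqrt hpos.le
      have hne : √(a ^ 2 + b ^ 2) ≠ 0 := (Real.sqrt_pos.mpr hpos).ne'
      refine ⟨b / √(a ^ 2 + b ^ 2), -a / √(a ^ 2 + b ^ 2), ?_, by ring⟩
      field_simp
      linarith
  refine ⟨x, c • y + s • J y, ⟨hx.1, hx.2⟩,
    (hwy.smul_right c).add_right ((hJ.map_right hwy).smul_right s),
    (hxy.smul_right c).add_right ((hJ.map_right hxy).smul_right s), hx1, ?_, ?_⟩
  · simp only [inner_add_left, inner_add_right, real_inner_smul_left, real_inner_smul_right,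
      hJ.inner_map, hJ.inner_self, hJ.inner_self', hy1]
    linear_combination hcs
  · simp only [map_add, map_smul, hJ.sq, hT.add_first, hT.add_second, hT.add_third,
      hT.smul_first, hT.smul_second, hT.smul_third, hT.self_first, hT.neg_first, smul_neg]
    rw [hT.swap_first (J y) y y x, hT.swap_first (J y) y (J y) x]
    linear_combination (c ^ 2 + s ^ 2) * hcs'

/-- The terms in which the second Bianchi identity differs from a derivative of `k`, written out
for a totally real orthonormal triple `w`, `x`, `y`, cancel when `T(Jy,y,y,x) = 0`. The vectors
`wX`, `xY`, … stand for the covariant derivatives `∇_w X`, `∇_x Y`, … of totally real orthonormal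
fields `W`, `X`, `Y` extending the triple. -/
theorem bianchi_correction_eq_zero {J : V →L[ℝ] V} {T : V → V → V → V → ℝ} {k : ℝ}
    (hJ : IsOrthogonalComplex J) (hT : IsCurvatureLike T) (hk : HasConstantAntiholomorphic J T k)
    {w x y : V} (hwx : IsTotallyReal J w x) (hwy : IsTotallyReal J w y)
    (hxy : IsTotallyReal J x y) (hw : inner ℝ w w = (1 : ℝ)) (hx : inner ℝ x x = (1 : ℝ))
    (hy : inner ℝ y y = (1 : ℝ)) (h0 : T (J y) y y x = 0) {wX wY xX xY xW yX yY yW : V}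
    (h1 : inner ℝ wX x = (0 : ℝ)) (h2 : inner ℝ wY y = (0 : ℝ))
    (h3 : inner ℝ xX w + inner ℝ xW x = (0 : ℝ)) (h4 : inner ℝ yY w + inner ℝ yW y = (0 : ℝ))
    (h5 : inner ℝ xX (J y) = (inner ℝ xY (J x) : ℝ))
    (h6 : inner ℝ yY (J x) = (inner ℝ yX (J y) : ℝ)) :
    T w (xY - yX) y x + T x (yW - wY) y x + T y (wX - xW) y x
      - T x y wY x - T y w xY x - T w x yY x
      - T x y y wX - T y w y xX - T w x y yX = 0 := by
  have hyx := hJ.symm hxy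
  have h0' : T (J x) x x y = 0 := by rw [curvature_antisymm hJ hT hk hxy hx hy, h0, neg_zero]
  have a1 := curvature_outer_general hJ hT hk wX hxy hy
  have a2 := curvature_outer_general hJ hT hk wY hyx hx
  have a3 := curvature_outer_general hJ hT hk xX hwy hy
  have a4 := curvature_outer_general hJ hT hk xW hxy hy
  have a5 := curvature_outer_general hJ hT hk yY hwx hx
  have a6 := curvature_outer_general hJ hT hk yW hyx hx
  have q1 := curvature_inner_general hJ hT hk xY hwx hwy hxy hw hx hy
  have q2 := curvature_inner_general hJ hT hk yX hwy hwx hyx hw hy hx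
  rw [h0] at a1 a4 q1
  rw [h0'] at a2 a6 q2
  rw [h1] at a1
  rw [h2] at a2
  have b1 : T x y y wX = T wX y y x := by rw [hT.pair_symm, hT.swap_first, hT.swap_last]; ring
  have b2 : T x y wY x = T wY x x y := by rw [hT.pair_symm]
  have b3 : T x wY y x = T wY x x y := by rw [hT.swap_first, hT.swap_last]; ring
  have b4 : T y w y xX = -T xX y y w := by rw [hT.pair_symm, hT.swap_first]
  have b5 : T w x yY x = -T yY x x w := by rw [hT.pair_symm, hT.swap_last]
  have b6 : T x yW y x = T yW x x y := by rw [hT.swap_first, hT.swap_last]; ring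
  simp only [sub_eq_add_neg, hT.add_second, hT.neg_second]
  rw [b1, b2, b3, b4, b5, b6, hT.swap_first w y xY x, hT.swap_first wX y y x,
    hT.swap_first xW y y x]
  have b7 : T w yX y x = -T w yX x y := by rw [hT.swap_last]
  have b8 : T w x y yX = -T w x yX y := by rw [hT.swap_last]
  rw [b7, b8]
  linear_combination (-2) * a1 - 2 * a2 + a3 + a4 + a5 + a6 + q1 + q2 + k * h3 + k * h4
    + T (J y) y y w * h5 + T (J x) x x w * h6

end Algebra

/-! ### Smooth fields and orthonormal frames -/

section Smooth

variable {E : Type*} [NormedAddCommGroup E] [NormedSpace ℝ E] [FiniteDimensional ℝ E]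
  {H : Type*} [TopologicalSpace H] {I : ModelWithCorners ℝ E H}
  {M : Type*} [TopologicalSpace M] [ChartedSpace H M] [IsManifold I ∞ M]
  [RiemannianBundle (fun x : M => TangentSpace I x)]
  [IsContMDiffRiemannianBundle I ∞ E (fun x : M => TangentSpace I x)]

theorem mdifferentiableAt_of_contMDiffAt {X : Π x : M, TangentSpace I x} {p : M}
    (hX : CMDiffAt ∞ (T% X) p) : MDiffAt (T% X) p :=
  hX.mdifferentiableAt (by simp)

theorem eventually_mdifferentiableAt {X : Π x : M, TangentSpace I x} {p : M}
    (hX : CMDiffAt ∞ (T% X) p) : ∀ᶠ q in 𝓝 p, MDiffAt (T% X) q := by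
  have h1 : CMDiffAt 1 (T% X) p := hX.of_le (by exact_mod_cast le_top)
  filter_upwards [(contMDiffAt_iff_contMDiffAt_nhds (by simp)).mp h1] with q hq
  exact hq.mdifferentiableAt (by simp)

theorem contMDiffAt_inner {X Y : Π x : M, TangentSpace I x} {p : M}
    (hX : CMDiffAt ∞ (T% X) p) (hY : CMDiffAt ∞ (T% Y) p) :
    CMDiffAt ∞ (fun q => (inner ℝ (X q) (Y q) : ℝ)) p :=
  ContMDiffAt.inner_bundle (IB := I) (F := E) (E := fun x : M => TangentSpace I x)
    (b := fun q => q) hX hY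

theorem contMDiffAt_mvfderiv_apply {f : M → ℝ} {X : Π x : M, TangentSpace I x} {p : M}
    (hf : CMDiffAt ∞ f p) (hX : CMDiffAt ∞ (T% X) p) :
    CMDiffAt ∞ (fun q => d% f q (X q)) p := by
  have h1 : ContMDiffAt I 𝓘(ℝ, E →L[ℝ] ℝ) ∞
      (inTangentCoordinates I 𝓘(ℝ, ℝ) id f (mfderiv% f) p) p :=
    hf.mfderiv_const (m := ∞) (by simp)
  have h2 := ContMDiffAt.clm_apply_of_inCoordinates (b₁ := fun q : M => q) (b₂ := f)
    (ϕ := fun q => mfderiv I 𝓘(ℝ, ℝ) f q) (v := X) h1 hX hf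
  rw [contMDiffAt_totalSpace] at h2
  refine h2.2.congr_of_eventuallyEq (.of_forall fun q => ?_)
  simp [trivializationAt_model_space_apply]
  rfl

theorem contMDiffAt_mlieBracket {X Y : Π x : M, TangentSpace I x} {p : M}
    (hX : CMDiffAt ∞ (T% X) p) (hY : CMDiffAt ∞ (T% Y) p) :
    CMDiffAt ∞ (T% (mlieBracket I X Y)) p := by
  have : IsManifold I ((⊤ : ℕ∞) + 1) M := by simpa using! (inferInstance : IsManifold I ∞ M)
  have : IsManifold I (minSmoothness ℝ 2) M := by
    rw [minSmoothness_of_isRCLikeNormedField]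
    exact IsManifold.of_le (n := ∞) (WithTop.coe_le_coe.mpr (le_top : (2 : ℕ∞) ≤ ⊤))
  exact ContMDiffAt.mlieBracket_vectorField (m := ⊤) (n := ⊤) hX hY (by simp)

theorem eventually_contMDiffAt_extend {p : M} (v : TangentSpace I p) :
    ∀ᶠ q in 𝓝 p, CMDiffAt ∞ (T% (FiberBundle.extend E v)) q := by
  obtain ⟨s, hs, h⟩ := FiberBundle.exists_contMDiffOn_extend (k := ∞) I E v
  filter_upwards [eventually_mem_nhds_iff.mpr hs] with q hq
  exact h.contMDiffAt hq

/-- A unit vector orthogonal to finitely many orthonormal smooth local fields extends to a smooth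
local unit field orthogonal to these fields. -/
theorem exists_unit_field {ι : Type*} [Fintype ι] {p : M} (e : ι → Π x : M, TangentSpace I x)
    (he : ∀ i, ∀ᶠ q in 𝓝 p, CMDiffAt ∞ (T% (e i)) q)
    (ho : ∀ᶠ q in 𝓝 p, Orthonormal ℝ (fun i => e i q))
    (v : TangentSpace I p) (hv : ‖v‖ = 1) (hve : ∀ i, inner ℝ (e i p) v = (0 : ℝ)) :
    ∃ V : Π x : M, TangentSpace I x, V p = v ∧ (∀ᶠ q in 𝓝 p, CMDiffAt ∞ (T% V) q) ∧
      (∀ᶠ q in 𝓝 p, ‖V q‖ = 1) ∧ ∀ i, ∀ᶠ q in 𝓝 p, inner ℝ (e i q) (V q) = (0 : ℝ) := by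
  set U : Π x : M, TangentSpace I x := FiberBundle.extend E v with hU
  have hUp : U p = v := by simp [hU]
  have hUs := eventually_contMDiffAt_extend v
  set Z : Π x : M, TangentSpace I x := U - fun q => ∑ i, (inner ℝ (e i q) (U q) : ℝ) • e i q with hZ
  have hZp : Z p = v := by simp [hZ, hUp, hve]
  have hZs : ∀ᶠ q in 𝓝 p, CMDiffAt ∞ (T% Z) q := by
    filter_upwards [hUs, eventually_all.mpr he] with q h1 h2
    refine h1.sub_section (ContMDiffAt.sum_section fun i _ => ?_)
    exact (contMDiffAt_inner (h2 i) h1).smul_section (h2 i)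
  have hZn : ∀ᶠ q in 𝓝 p, inner ℝ (Z q) (Z q) ≠ (0 : ℝ) := by
    have h1 : ContinuousAt (fun q => (inner ℝ (Z q) (Z q) : ℝ)) p :=
      (contMDiffAt_inner hZs.self_of_nhds hZs.self_of_nhds).continuousAt
    refine h1.eventually_ne ?_
    rw [hZp, real_inner_self_eq_norm_sq, hv]
    norm_num
  have hZo : ∀ i, ∀ᶠ q in 𝓝 p, inner ℝ (e i q) (Z q) = (0 : ℝ) := by
    intro i
    filter_upwards [ho] with q hq
    simp only [hZ, Pi.sub_apply, inner_sub_right]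
    rw [hq.inner_right_fintype, sub_self]
  refine ⟨(fun q => (√(inner ℝ (Z q) (Z q)))⁻¹) • Z, ?_, ?_, ?_, fun i => ?_⟩
  · simp [hZp, hv]
  · filter_upwards [hZs, hZn] with q h1 h2
    refine ContMDiffAt.smul_section ?_ h1
    have h3 : ContDiffAt ℝ ∞ (fun t : ℝ => (√t)⁻¹) (inner ℝ (Z q) (Z q)) :=
      (Real.contDiffAt_sqrt h2).inv
        (Real.sqrt_ne_zero'.mpr (lt_of_le_of_ne real_inner_self_nonneg h2.symm))
    exact ContMDiffAt.comp (g := fun t : ℝ => (√t)⁻¹) q h3.contMDiffAt (contMDiffAt_inner h1 h1)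
  · filter_upwards [hZn] with q h
    have h0 : ‖Z q‖ ≠ 0 := fun h' => h (by rw [real_inner_self_eq_norm_sq, h']; norm_num)
    simp [norm_smul, h0]
  · filter_upwards [hZo i] with q h
    simp [inner_smul_right, h]

/-- Smooth local orthonormal frames exist. -/
theorem exists_orthonormal_frame (p : M) :
    ∃ e : Fin (finrank ℝ E) → Π x : M, TangentSpace I x,
      (∀ i, ∀ᶠ q in 𝓝 p, CMDiffAt ∞ (T% (e i)) q) ∧
      ∀ᶠ q in 𝓝 p, Orthonormal ℝ (fun i => e i q) := by
  have hfin : finrank ℝ (TangentSpace I p) = finrank ℝ E := rfl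
  let b := (stdOrthonormalBasis ℝ (TangentSpace I p)).reindex (finCongr hfin)
  suffices h : ∀ k (hk : k ≤ finrank ℝ E), ∃ e : Fin k → Π x : M, TangentSpace I x,
      (∀ i, e i p = b (Fin.castLE hk i)) ∧
      (∀ i, ∀ᶠ q in 𝓝 p, CMDiffAt ∞ (T% (e i)) q) ∧
      ∀ᶠ q in 𝓝 p, Orthonormal ℝ (fun i => e i q) by
    obtain ⟨e, -, h⟩ := h _ le_rfl
    exact ⟨e, h⟩
  intro k
  induction k with
  | zero => exact fun _ => ⟨fun i => i.elim0, fun i => i.elim0, fun i => i.elim0,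
      .of_forall fun q => ⟨fun i => i.elim0, fun i => i.elim0⟩⟩
  | succ k ih =>
    intro hk
    obtain ⟨e, he, hs, ho⟩ := ih (by omega)
    obtain ⟨V, hVp, hVs, hV1, hVo⟩ := exists_unit_field e hs ho (b ⟨k, hk⟩) (b.orthonormal.1 _)
      (fun i => by
        rw [he]
        refine b.orthonormal.2 fun h => ?_
        have := congrArg Fin.val h
        simp at this
        omega)
    refine ⟨Fin.snoc e V, fun i => ?_, fun i => ?_, ?_⟩
    · induction i using Fin.lastCases with
      | last => rw [Fin.snoc_last, hVp]; rfl
      | cast i => simp [he, Fin.castLE]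
    · induction i using Fin.lastCases with
      | last => simpa using hVs
      | cast i => simpa using hs i
    · filter_upwards [ho, hV1, eventually_all.mpr hVo] with q h1 h2 h3
      refine ⟨fun i => ?_, fun i j hij => ?_⟩
      · induction i using Fin.lastCases with
        | last => simpa using h2
        | cast i => simpa using h1.1 i
      · induction i using Fin.lastCases with
        | last =>
          induction j using Fin.lastCases with
          | last => exact absurd rfl hij
          | cast j => simpa [real_inner_comm] using h3 j
        | cast i =>
          induction j using Fin.lastCases with
          | last => simpa using h3 i
          | cast j => simpa using h1.2 (fun h => hij (by rw [h]))

theorem sum_inner_smul_orthonormal {q : M}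
    {e : Fin (finrank ℝ E) → TangentSpace I q} (he : Orthonormal ℝ e) (v : TangentSpace I q) :
    ∑ i, (inner ℝ (e i) v : ℝ) • e i = v := by
  have hfin : Fintype.card (Fin (finrank ℝ E)) = finrank ℝ (TangentSpace I q) := by
    rw [Fintype.card_fin]; rfl
  let b := OrthonormalBasis.mk he (he.linearIndependent.span_eq_top_of_card_eq_finrank' hfin).ge
  have hb : ⇑b = e := OrthonormalBasis.coe_mk _ _
  simpa [hb] using b.sum_repr' v

end Smooth

/-! ### The Levi-Civita connection on smooth fields -/

section Connection

variable {E : Type*} [NormedAddCommGroup E] [NormedSpace ℝ E] [FiniteDimensional ℝ E]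
  {H : Type*} [TopologicalSpace H] {I : ModelWithCorners ℝ E H}
  {M : Type*} [TopologicalSpace M] [ChartedSpace H M] [IsManifold I ∞ M]
  [RiemannianBundle (fun x : M => TangentSpace I x)]
  [IsContMDiffRiemannianBundle I ∞ E (fun x : M => TangentSpace I x)]

variable (I) in
/-- The vector field `∇_X Y`. -/
def nabla (X Y : Π x : M, TangentSpace I x) (p : M) : TangentSpace I p :=
  leviCivita I M Y p (X p)

variable {X Y Z W U : Π x : M, TangentSpace I x} {p : M}

theorem contMDiffAt_koszul (hY : CMDiffAt ∞ (T% Y) p) (hX : CMDiffAt ∞ (T% X) p)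
    (hZ : CMDiffAt ∞ (T% Z) p) : CMDiffAt ∞ (fun q => koszul I Y X Z q) p := by
  have hadd {f g : M → ℝ} (hf : CMDiffAt ∞ f p) (hg : CMDiffAt ∞ g p) :
      CMDiffAt ∞ (fun q => f q + g q) p := hf.add hg
  have hsub {f g : M → ℝ} (hf : CMDiffAt ∞ f p) (hg : CMDiffAt ∞ g p) :
      CMDiffAt ∞ (fun q => f q - g q) p := hf.sub hg
  refine ContMDiffAt.mul contMDiffAt_const ?_
  exact hadd (hsub (hadd (hsub (hadd (contMDiffAt_mvfderiv_apply (contMDiffAt_inner hY hZ) hX)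
    (contMDiffAt_mvfderiv_apply (contMDiffAt_inner hZ hX) hY))
    (contMDiffAt_mvfderiv_apply (contMDiffAt_inner hX hY) hZ))
    (contMDiffAt_inner (contMDiffAt_mlieBracket hX hY) hZ))
    (contMDiffAt_inner (contMDiffAt_mlieBracket hY hZ) hX))
    (contMDiffAt_inner (contMDiffAt_mlieBracket hZ hX) hY)

theorem inner_nabla (hX : MDiffAt (T% X) p) (hY : MDiffAt (T% Y) p) (hZ : MDiffAt (T% Z) p) :
    inner ℝ (nabla I X Y p) (Z p) = koszul I Y X Z p :=
  inner_leviCivitaFun_apply hY hX hZ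

theorem contMDiffAt_nabla (hX : CMDiffAt ∞ (T% X) p) (hY : CMDiffAt ∞ (T% Y) p) :
    CMDiffAt ∞ (T% (nabla I X Y)) p := by
  obtain ⟨e, hs, ho⟩ := exists_orthonormal_frame (I := I) p
  have h1 : CMDiffAt ∞ (T% (fun q => ∑ i, koszul I Y X (e i) q • e i q)) p :=
    ContMDiffAt.sum_section fun i _ =>
      (contMDiffAt_koszul hY hX (hs i).self_of_nhds).smul_section (hs i).self_of_nhds
  refine h1.congr_of_eventuallyEq ?_
  filter_upwards [ho, eventually_mdifferentiableAt hX, eventually_mdifferentiableAt hY,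
    eventually_all.mpr fun i => eventually_mdifferentiableAt (hs i).self_of_nhds] with q h hX hY he
  have h2 := sum_inner_smul_orthonormal h (nabla I X Y q)
  have h3 : ∑ i, koszul I Y X (e i) q • e i q = nabla I X Y q := by
    rw [← h2]
    refine Finset.sum_congr rfl fun i _ => ?_
    rw [← inner_nabla hX hY (he i), real_inner_comm]
  simp only [h3]

/-- `∇_X Y` is differentiable if `X` is only differentiable and `Y` is smooth. -/
theorem mdifferentiableAt_nabla (hX : MDiffAt (T% X) p) (hY : CMDiffAt ∞ (T% Y) p) :
    MDiffAt (T% (nabla I X Y)) p := by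
  obtain ⟨e, hs, ho⟩ := exists_orthonormal_frame (I := I) p
  have h1 : MDiffAt (T% (fun q => ∑ i, (inner ℝ (e i q) (X q) : ℝ) • nabla I (e i) Y q)) p :=
    MDifferentiableAt.sum_section fun i _ =>
      (mdifferentiableAt_inner (mdifferentiableAt_of_contMDiffAt (hs i).self_of_nhds)
        hX).smul_section
        (mdifferentiableAt_of_contMDiffAt (contMDiffAt_nabla (hs i).self_of_nhds hY))
  refine h1.congr_of_eventuallyEq ?_
  filter_upwards [ho] with q h
  have h3 : ∑ i, (inner ℝ (e i q) (X q) : ℝ) • nabla I (e i) Y q = nabla I X Y q := by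
    simp only [nabla, ← map_smul, ← map_sum, sum_inner_smul_orthonormal h]
  simp only [h3]

theorem nabla_add_right (hY : MDiffAt (T% Y) p) (hZ : MDiffAt (T% Z) p) :
    nabla I X (Y + Z) p = nabla I X Y p + nabla I X Z p := by
  simp only [nabla]
  rw [(leviCivita I M).isCovariantDerivativeOnUniv.add hY hZ]
  rfl

theorem nabla_smul_right {f : M → ℝ} (hf : MDiffAt f p) (hY : MDiffAt (T% Y) p) :
    nabla I X (f • Y) p = f p • nabla I X Y p + (d% f p (X p)) • Y p := by
  simp only [nabla]
  rw [(leviCivita I M).isCovariantDerivativeOnUniv.leibniz hY hf]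
  rfl

theorem nabla_sub_right (hY : MDiffAt (T% Y) p) (hZ : MDiffAt (T% Z) p) :
    nabla I X (Y - Z) p = nabla I X Y p - nabla I X Z p := by
  have h := nabla_add_right (X := X) (mdifferentiableAt_sub_section hY hZ) hZ
  rw [sub_add_cancel] at h
  rw [h, add_sub_cancel_right]

theorem nabla_congr (hY : MDiffAt (T% Y) p) (hYZ : ∀ᶠ q in 𝓝 p, Y q = Z q) :
    nabla I X Y p = nabla I X Z p := by
  have hZ : MDiffAt (T% Z) p :=
    hY.congr_of_eventuallyEq (hYZ.mono fun q h => by simp only [h])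
  simp only [nabla]
  rw [(leviCivita I M).isCovariantDerivativeOnUniv.congr_of_eventuallyEq hY hZ univ_mem hYZ]

theorem mlieBracket_eq_nabla_sub (hX : MDiffAt (T% X) p) (hY : MDiffAt (T% Y) p) :
    mlieBracket I X Y p = nabla I X Y p - nabla I Y X p :=
  ((leviCivita I M).torsion_eq_zero_iff.mp leviCivita_torsion hX hY).symm

theorem mvfderiv_inner (hX : MDiffAt (T% X) p) (hY : MDiffAt (T% Y) p) (hZ : MDiffAt (T% Z) p) :
    (d% (fun q => (inner ℝ (Y q) (Z q) : ℝ)) p) (X p)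
      = inner ℝ (nabla I X Y p) (Z p) + inner ℝ (Y p) (nabla I X Z p) :=
  leviCivita_metric hX hY hZ

theorem jacobi (hX : CMDiffAt ∞ (T% X) p) (hY : CMDiffAt ∞ (T% Y) p) (hZ : CMDiffAt ∞ (T% Z) p) :
    mlieBracket I X (mlieBracket I Y Z) p = mlieBracket I (mlieBracket I X Y) Z p +
      mlieBracket I Y (mlieBracket I X Z) p := by
  have : IsManifold I (minSmoothness ℝ 3) M := by
    rw [minSmoothness_of_isRCLikeNormedField]
    exact IsManifold.of_le (n := ∞) (WithTop.coe_le_coe.mpr (le_top : (3 : ℕ∞) ≤ ⊤))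
  have hle : minSmoothness ℝ 2 ≤ (∞ : WithTop ℕ∞) := by
    rw [minSmoothness_of_isRCLikeNormedField]
    exact WithTop.coe_le_coe.mpr (le_top : (2 : ℕ∞) ≤ ⊤)
  exact leibniz_identity_mlieBracket_apply (hX.of_le hle) (hY.of_le hle) (hZ.of_le hle)

/-- `[X,Y] f = X (Y f) - Y (X f)`, by comparing the Jacobi identities for `X`, `Y`, `Z` and for
`X`, `Y`, `f Z`, where `Z` is a field that does not vanish at `p`. -/
theorem mvfderiv_mlieBracket {f : M → ℝ} (hf : CMDiffAt ∞ f p) (hX : CMDiffAt ∞ (T% X) p)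
    (hY : CMDiffAt ∞ (T% Y) p) :
    d% f p (mlieBracket I X Y p) =
      d% (fun q => d% f q (Y q)) p (X p) - d% (fun q => d% f q (X q)) p (Y p) := by
  have hf' : ∀ᶠ q in 𝓝 p, MDiffAt f q := by
    have h1 : CMDiffAt 1 f p := hf.of_le (by exact_mod_cast le_top)
    filter_upwards [(contMDiffAt_iff_contMDiffAt_nhds (by simp)).mp h1] with q hq
    exact hq.mdifferentiableAt (by simp)
  have key (v : TangentSpace I p) :
      (d% (fun q => d% f q (Y q)) p (X p) - d% (fun q => d% f q (X q)) p (Y p)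
        - d% f p (mlieBracket I X Y p)) • v = 0 := by
    set Z : Π x : M, TangentSpace I x := FiberBundle.extend E v with hZ
    have hZp : Z p = v := by simp [hZ]
    have hZs : CMDiffAt ∞ (T% Z) p := (eventually_contMDiffAt_extend v).self_of_nhds
    have hfd {g : M → ℝ} (hg : CMDiffAt ∞ g p) : MDiffAt g p := hg.mdifferentiableAt (by simp)
    have expand {A B : Π x : M, TangentSpace I x} (hA : CMDiffAt ∞ (T% A) p)
        (hB : CMDiffAt ∞ (T% B) p) :
        mlieBracket I A (mlieBracket I B (f • Z)) p =
          d% (fun q => d% f q (B q)) p (A p) • Z p + d% f p (B p) • mlieBracket I A Z p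
          + (d% f p (A p) • mlieBracket I B Z p + f p • mlieBracket I A (mlieBracket I B Z) p) := by
      have h1 : mlieBracket I B (f • Z) =ᶠ[𝓝 p]
          ((fun q => d% f q (B q)) • Z + f • mlieBracket I B Z) := by
        filter_upwards [hf', eventually_mdifferentiableAt hZs] with q h1 h2
        rw [mlieBracket_smul_right h1 h2]
        rfl
      have s1 := contMDiffAt_mvfderiv_apply hf hB
      have s2 := contMDiffAt_mlieBracket hB hZs
      rw [(EventuallyEq.refl _ A).mlieBracket_vectorField_eq h1,
        mlieBracket_add_right (mdifferentiableAt_of_contMDiffAt (s1.smul_section hZs))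
          (mdifferentiableAt_of_contMDiffAt (hf.smul_section s2)),
        mlieBracket_smul_right (hfd s1) (mdifferentiableAt_of_contMDiffAt hZs),
        mlieBracket_smul_right (hfd hf) (mdifferentiableAt_of_contMDiffAt s2)]
    have h1 := jacobi hX hY (hf.smul_section hZs)
    rw [expand hX hY, expand hY hX,
      mlieBracket_smul_right (hfd hf) (mdifferentiableAt_of_contMDiffAt hZs),
      jacobi hX hY hZs, hZp] at h1
    refine Eq.trans ?_ (sub_eq_zero.mpr h1)
    module
  by_cases h : ∃ v : TangentSpace I p, v ≠ 0
  · obtain ⟨v, hv⟩ := h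
    have := (smul_eq_zero.mp (key v)).resolve_right hv
    linarith
  · push Not at h
    rw [h (mlieBracket I X Y p), h (X p), h (Y p)]
    simp

end Connection

/-! ### Symmetries and tensoriality of the curvature -/

section CurvatureTensor

variable {E : Type*} [NormedAddCommGroup E] [NormedSpace ℝ E] [FiniteDimensional ℝ E]
  {H : Type*} [TopologicalSpace H] {I : ModelWithCorners ℝ E H}
  {M : Type*} [TopologicalSpace M] [ChartedSpace H M] [IsManifold I ∞ M]
  [RiemannianBundle (fun x : M => TangentSpace I x)]
  [IsContMDiffRiemannianBundle I ∞ E (fun x : M => TangentSpace I x)]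

variable {X Y Z W U : Π x : M, TangentSpace I x} {p : M}

theorem mvfderiv_congr {f g : M → ℝ} (h : f =ᶠ[𝓝 p] g) : d% f p = d% g p :=
  ContinuousLinearMap.ext fun v => congrArg (fun L : E →L[ℝ] ℝ => L v) h.mfderiv_eq

theorem curvatureField_eq : curvatureField I X Y Z p = nabla I X (nabla I Y Z) p
    - nabla I Y (nabla I X Z) p - nabla I (mlieBracket I X Y) Z p := rfl

theorem contMDiffAt_curvatureField (hX : CMDiffAt ∞ (T% X) p) (hY : CMDiffAt ∞ (T% Y) p)
    (hZ : CMDiffAt ∞ (T% Z) p) : CMDiffAt ∞ (T% (curvatureField I X Y Z)) p :=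
  ((contMDiffAt_nabla hX (contMDiffAt_nabla hY hZ)).sub_section
    (contMDiffAt_nabla hY (contMDiffAt_nabla hX hZ))).sub_section
    (contMDiffAt_nabla (contMDiffAt_mlieBracket hX hY) hZ)

theorem curvatureField_swap : curvatureField I Y X Z p = -curvatureField I X Y Z p := by
  simp only [curvatureField_eq, nabla]
  rw [mlieBracket_swap_apply, map_neg]
  abel

/-- The curvature operator is skew-adjoint: apply `[X,Y] - (XY - YX)` to `⟨Z,U⟩`. -/
theorem inner_curvatureField_swap (hX : CMDiffAt ∞ (T% X) p) (hY : CMDiffAt ∞ (T% Y) p)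
    (hZ : CMDiffAt ∞ (T% Z) p) (hU : CMDiffAt ∞ (T% U) p) :
    inner ℝ (curvatureField I X Y Z p) (U p) =
      -(inner ℝ (Z p) (curvatureField I X Y U p) : ℝ) := by
  have md {A : Π x : M, TangentSpace I x} (h : CMDiffAt ∞ (T% A) p) : MDiffAt (T% A) p :=
    mdifferentiableAt_of_contMDiffAt h
  have second {A B : Π x : M, TangentSpace I x} (hA : CMDiffAt ∞ (T% A) p)
      (hB : CMDiffAt ∞ (T% B) p) :
      d% (fun q => d% (fun r => (inner ℝ (Z r) (U r) : ℝ)) q (B q)) p (A p) =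
        (inner ℝ (nabla I A (nabla I B Z) p) (U p) + inner ℝ (nabla I B Z p) (nabla I A U p))
        + (inner ℝ (nabla I A Z p) (nabla I B U p) + inner ℝ (Z p) (nabla I A (nabla I B U) p)) := by
    have h1 : (fun q => d% (fun r => (inner ℝ (Z r) (U r) : ℝ)) q (B q)) =ᶠ[𝓝 p]
        fun q => inner ℝ (nabla I B Z q) (U q) + inner ℝ (Z q) (nabla I B U q) := by
      filter_upwards [eventually_mdifferentiableAt hB, eventually_mdifferentiableAt hZ,
        eventually_mdifferentiableAt hU] with q h1 h2 h3
      exact mvfderiv_inner h1 h2 h3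
    have h2 : d% (fun q => d% (fun r => (inner ℝ (Z r) (U r) : ℝ)) q (B q)) p =
        d% (fun q => (inner ℝ (nabla I B Z q) (U q) + inner ℝ (Z q) (nabla I B U q) : ℝ)) p :=
      mvfderiv_congr h1
    have s1 := contMDiffAt_nabla hB hZ
    have s2 := contMDiffAt_nabla hB hU
    rw [h2, mvfderiv_fun_add (mdifferentiableAt_inner (md s1) (md hU))
      (mdifferentiableAt_inner (md hZ) (md s2)), _root_.add_apply,
      mvfderiv_inner (md hA) (md s1) (md hU), mvfderiv_inner (md hA) (md hZ) (md s2)]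
  have h := mvfderiv_mlieBracket (contMDiffAt_inner hZ hU) hX hY
  rw [second hX hY, second hY hX,
    mvfderiv_inner (md (contMDiffAt_mlieBracket hX hY)) (md hZ) (md hU)] at h
  simp only [curvatureField_eq, inner_sub_left, inner_sub_right]
  linarith

/-- First Bianchi identity. -/
theorem curvatureField_bianchi (hX : CMDiffAt ∞ (T% X) p) (hY : CMDiffAt ∞ (T% Y) p)
    (hZ : CMDiffAt ∞ (T% Z) p) :
    curvatureField I X Y Z p + curvatureField I Y Z X p + curvatureField I Z X Y p = 0 := by
  have key {A B C : Π x : M, TangentSpace I x} (hA : CMDiffAt ∞ (T% A) p)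
      (hB : CMDiffAt ∞ (T% B) p) (hC : CMDiffAt ∞ (T% C) p) :
      nabla I A (nabla I B C) p - nabla I A (nabla I C B) p - nabla I (mlieBracket I B C) A p =
        mlieBracket I A (mlieBracket I B C) p := by
    have s := contMDiffAt_mlieBracket hB hC
    rw [mlieBracket_eq_nabla_sub (mdifferentiableAt_of_contMDiffAt hA)
        (mdifferentiableAt_of_contMDiffAt s),
      ← nabla_sub_right (mdifferentiableAt_of_contMDiffAt (contMDiffAt_nabla hB hC))
        (mdifferentiableAt_of_contMDiffAt (contMDiffAt_nabla hC hB))]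
    congr 1
    symm
    refine nabla_congr (mdifferentiableAt_of_contMDiffAt s) ?_
    filter_upwards [eventually_mdifferentiableAt hB, eventually_mdifferentiableAt hC] with q h1 h2
    exact mlieBracket_eq_nabla_sub h1 h2
  have h1 := key hX hY hZ
  have h2 := key hY hZ hX
  have h3 := key hZ hX hY
  have h4 := jacobi hX hY hZ
  rw [mlieBracket_swap_apply (V := mlieBracket I X Y), mlieBracket_swap (V := X) (W := Z)] at h4
  have h5 : mlieBracket I Y (-mlieBracket I Z X) p = -mlieBracket I Y (mlieBracket I Z X) p := by
    have := mlieBracket_const_smul_right (V := Y) (c := (-1 : ℝ))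
      (mdifferentiableAt_of_contMDiffAt (contMDiffAt_mlieBracket hZ hX))
    simpa using this
  rw [h5, ← h1, ← h2, ← h3] at h4
  simp only [curvatureField_eq]
  rw [← sub_eq_zero] at h4
  refine Eq.trans ?_ h4
  abel

/-- Second Bianchi identity for vector fields, with the Lie brackets kept. It follows from the
Jacobi identities for the operators `∇_W`, `∇_X`, `∇_Y` and for the fields `W`, `X`, `Y`. -/
theorem curvatureField_second_bianchi (hW : CMDiffAt ∞ (T% W) p) (hX : CMDiffAt ∞ (T% X) p)
    (hY : CMDiffAt ∞ (T% Y) p) (hZ : CMDiffAt ∞ (T% Z) p) :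
    (nabla I W (curvatureField I X Y Z) p - curvatureField I X Y (nabla I W Z) p
      + curvatureField I W (mlieBracket I X Y) Z p)
    + (nabla I X (curvatureField I Y W Z) p - curvatureField I Y W (nabla I X Z) p
      + curvatureField I X (mlieBracket I Y W) Z p)
    + (nabla I Y (curvatureField I W X Z) p - curvatureField I W X (nabla I Y Z) p
      + curvatureField I Y (mlieBracket I W X) Z p) = 0 := by
  have md {A : Π x : M, TangentSpace I x} (h : CMDiffAt ∞ (T% A) p) : MDiffAt (T% A) p :=
    mdifferentiableAt_of_contMDiffAt h
  have expand {A B C : Π x : M, TangentSpace I x} (hA : CMDiffAt ∞ (T% A) p)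
      (hB : CMDiffAt ∞ (T% B) p) (hC : CMDiffAt ∞ (T% C) p) :
      nabla I A (curvatureField I B C Z) p = nabla I A (nabla I B (nabla I C Z)) p
        - nabla I A (nabla I C (nabla I B Z)) p - nabla I A (nabla I (mlieBracket I B C) Z) p := by
    have s1 := contMDiffAt_nabla hB (contMDiffAt_nabla hC hZ)
    have s2 := contMDiffAt_nabla hC (contMDiffAt_nabla hB hZ)
    have s3 := contMDiffAt_nabla (contMDiffAt_mlieBracket hB hC) hZ
    have h := nabla_sub_right (X := A) (md (s1.sub_section s2)) (md s3)
    rw [nabla_sub_right (md s1) (md s2)] at h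
    exact h
  have hj : mlieBracket I W (mlieBracket I X Y) p + mlieBracket I X (mlieBracket I Y W) p
      + mlieBracket I Y (mlieBracket I W X) p = 0 := by
    have h4 := jacobi hW hX hY
    rw [mlieBracket_swap_apply (V := mlieBracket I W X), mlieBracket_swap (V := W) (W := Y)] at h4
    have h5 : mlieBracket I X (-mlieBracket I Y W) p = -mlieBracket I X (mlieBracket I Y W) p := by
      have := mlieBracket_const_smul_right (V := X) (c := (-1 : ℝ))
        (mdifferentiableAt_of_contMDiffAt (contMDiffAt_mlieBracket hY hW))
      simpa using this
    rw [h4, h5]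
    abel
  have hj' : nabla I (mlieBracket I W (mlieBracket I X Y)) Z p
      + nabla I (mlieBracket I X (mlieBracket I Y W)) Z p
      + nabla I (mlieBracket I Y (mlieBracket I W X)) Z p = 0 := by
    simp only [nabla]
    rw [← map_add, ← map_add, hj, map_zero]
  rw [expand hW hX hY, expand hX hY hW, expand hY hW hX]
  simp only [curvatureField_eq]
  rw [← neg_eq_zero] at hj'
  refine Eq.trans ?_ hj'
  abel

theorem curvatureField_tensorial_first (hZ : CMDiffAt ∞ (T% Z) p) :
    TensorialAt I E (fun X => curvatureField I X Y Z p) p where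
  smul {f X} hf hX := by
    have h1 : nabla I (f • X) Z = f • nabla I X Z := by
      funext q
      simp [nabla]
    simp only [curvatureField_eq]
    rw [h1, nabla_smul_right hf (mdifferentiableAt_nabla hX hZ)]
    simp only [nabla]
    rw [mlieBracket_smul_left hf hX]
    simp only [Pi.smul_apply', map_add, map_smul, neg_smul, map_neg]
    module
  add {X X'} hX hX' := by
    have h1 : nabla I (X + X') Z = nabla I X Z + nabla I X' Z := by
      funext q
      simp [nabla]
    simp only [curvatureField_eq]
    rw [h1, nabla_add_right (mdifferentiableAt_nabla hX hZ) (mdifferentiableAt_nabla hX' hZ)]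
    simp only [nabla]
    rw [mlieBracket_add_left hX hX']
    simp only [Pi.add_apply, map_add]
    abel

/-- The curvature of smooth fields at `p` depends only on their values at `p`. In the argument `Z`,
which is differentiated twice, this follows from skewness, since `⟨R(X,Y)U,Z⟩` does not differentiate
`Z`. -/
theorem curvatureField_congr {X' Y' Z' : Π x : M, TangentSpace I x}
    (hX : CMDiffAt ∞ (T% X) p) (hY : CMDiffAt ∞ (T% Y) p) (hZ : CMDiffAt ∞ (T% Z) p)
    (hX' : CMDiffAt ∞ (T% X') p) (hY' : CMDiffAt ∞ (T% Y') p) (hZ' : CMDiffAt ∞ (T% Z') p)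
    (h1 : X p = X' p) (h2 : Y p = Y' p) (h3 : Z p = Z' p) :
    curvatureField I X Y Z p = curvatureField I X' Y' Z' p := by
  have md {A : Π x : M, TangentSpace I x} (h : CMDiffAt ∞ (T% A) p) : MDiffAt (T% A) p :=
    mdifferentiableAt_of_contMDiffAt h
  have e1 : curvatureField I X Y Z p = curvatureField I X' Y Z p :=
    (curvatureField_tensorial_first hZ).pointwise (md hX) (md hX') h1
  have e2 : curvatureField I Y X' Z p = curvatureField I Y' X' Z p :=
    (curvatureField_tensorial_first hZ).pointwise (md hY) (md hY') h2
  rw [e1, curvatureField_swap, e2, ← curvatureField_swap]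
  refine ext_inner_right ℝ fun u => ?_
  have hu : FiberBundle.extend E u p = u := by simp
  have hus := (eventually_contMDiffAt_extend (I := I) u).self_of_nhds
  have h4 := inner_curvatureField_swap hX' hY' hZ hus
  have h5 := inner_curvatureField_swap hX' hY' hZ' hus
  rw [hu] at h4 h5
  rw [h4, h5, h3]

/-- The curvature tensor can be computed with arbitrary smooth fields through the given vectors. -/
theorem curvature_apply (hX : CMDiffAt ∞ (T% X) p) (hY : CMDiffAt ∞ (T% Y) p)
    (hZ : CMDiffAt ∞ (T% Z) p) (u : TangentSpace I p) :
    curvature I p (X p) (Y p) (Z p) u = inner ℝ (curvatureField I X Y Z p) u := by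
  have hs (v : TangentSpace I p) := (eventually_contMDiffAt_extend (I := I) v).self_of_nhds
  rw [curvature, curvatureField_congr (hs _) (hs _) (hs _) hX hY hZ] <;> simp

theorem isCurvatureLike_curvature (p : M) : IsCurvatureLike (curvature I p) := by
  have hs (v : TangentSpace I p) := (eventually_contMDiffAt_extend (I := I) v).self_of_nhds
  have md {A : Π x : M, TangentSpace I x} (h : CMDiffAt ∞ (T% A) p) : MDiffAt (T% A) p :=
    mdifferentiableAt_of_contMDiffAt h
  have he (v : TangentSpace I p) : FiberBundle.extend E v p = v := by simp
  refine ⟨fun x x' y z u => ?_, fun c x y z u => ?_, fun x y z u => ?_, fun x y z u => ?_,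
    fun x y z u => ?_⟩
  · have h := (curvatureField_tensorial_first (Y := FiberBundle.extend E y) (hs z)).add (md (hs x)) (md (hs x'))
    have h' := curvature_apply ((hs x).add_section (hs x')) (hs y) (hs z) u
    simp only [Pi.add_apply, he] at h'
    rw [h', h, inner_add_left]
    rfl
  · have h := (curvatureField_tensorial_first (Y := FiberBundle.extend E y) (hs z)).smul (f := fun _ => c)
      mdifferentiableAt_const (md (hs x))
    have h' := curvature_apply ((contMDiffAt_const (c := c)).smul_section (hs x)) (hs y) (hs z) u
    simp only [Pi.smul_apply', he] at h'
    rw [h', h, real_inner_smul_left]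
    rfl
  · rw [curvature, curvatureField_swap, inner_neg_left]
    rfl
  · have h := inner_curvatureField_swap (hs x) (hs y) (hs z) (hs u)
    rw [he, he] at h
    rw [curvature, curvature, h, neg_neg, real_inner_comm]
  · have h := curvatureField_bianchi (hs x) (hs y) (hs z)
    simp only [curvature, ← inner_add_left]
    rw [h, inner_zero_left]

end CurvatureTensor

/-! ### Orthonormal families adapted to a complex structure -/

section Orthonormal

variable {V : Type*} [NormedAddCommGroup V] [InnerProductSpace ℝ V]

theorem orthonormal_pair {a b : V} (ha : ‖a‖ = 1) (hb : ‖b‖ = 1) (hab : inner ℝ a b = (0 : ℝ)) :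
    Orthonormal ℝ ![a, b] := by
  have hba : inner ℝ b a = (0 : ℝ) := by rw [real_inner_comm, hab]
  refine ⟨fun i => ?_, fun i j hij => ?_⟩
  · fin_cases i <;> simp [ha, hb]
  · fin_cases i <;> fin_cases j <;> first | exact absurd rfl hij | simpa using ‹_›

variable {J : V →L[ℝ] V} (hJ : IsOrthogonalComplex J)
include hJ

theorem IsOrthogonalComplex.norm_map (w : V) : ‖J w‖ = ‖w‖ := by
  have h := hJ.inner_map w w
  rw [real_inner_self_eq_norm_sq, real_inner_self_eq_norm_sq] at h
  exact (sq_eq_sq₀ (norm_nonneg _) (norm_nonneg _)).mp h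

theorem orthonormal_map_pair {w : V} (hw : ‖w‖ = 1) : Orthonormal ℝ ![w, J w] :=
  orthonormal_pair hw (by rw [hJ.norm_map, hw]) (hJ.inner_self' w)

theorem orthonormal_map_pairs {w x : V} (hw : ‖w‖ = 1) (hx : ‖x‖ = 1)
    (hwx : IsTotallyReal J w x) : Orthonormal ℝ ![w, J w, x, J x] := by
  have hxw := hJ.symm hwx
  refine ⟨fun i => ?_, fun i j hij => ?_⟩
  · fin_cases i <;> simp [hJ.norm_map, hw, hx]
  · fin_cases i <;> fin_cases j <;>
      first
      | exact absurd rfl hij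
      | simp [hJ.inner_self, hJ.inner_self', hJ.inner_map, hwx.1, hwx.2, hxw.1, hxw.2,
          hwx.inner_map_right hJ, hxw.inner_map_right hJ]

end Orthonormal

/-! ### Functions with vanishing differential -/

section Constancy

/-- A differentiable function with vanishing differential on a connected manifold is constant. -/
theorem exists_eq_const_of_mvfderiv_eq_zero {E : Type*} [NormedAddCommGroup E] [NormedSpace ℝ E]
    {M : Type*} [TopologicalSpace M] [ConnectedSpace M] [ChartedSpace E M]
    [IsManifold 𝓘(ℝ, E) ∞ M] {f : M → ℝ} (hf : ∀ p, MDifferentiableAt 𝓘(ℝ, E) 𝓘(ℝ, ℝ) f p)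
    (hf0 : ∀ p, ∀ v : TangentSpace 𝓘(ℝ, E) p, d% f p v = 0) : ∃ c : ℝ, ∀ p : M, f p = c := by
  have hloc : IsLocallyConstant f := by
    rw [IsLocallyConstant.iff_eventually_eq]
    intro p
    set e := chartAt E p with he
    have hpe : p ∈ e.source := mem_chart_source E p
    obtain ⟨r, hr, hB⟩ := Metric.isOpen_iff.mp e.open_target (e p) (e.map_source hpe)
    have hder : ∀ u ∈ Metric.ball (e p) r, HasFDerivAt (f ∘ e.symm) (0 : E →L[ℝ] ℝ) u := by
      intro u hu
      have h1 : MDifferentiableAt 𝓘(ℝ, E) 𝓘(ℝ, E) e.symm u :=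
        mdifferentiableAt_atlas_symm (chart_mem_atlas E p) (hB hu)
      have h2 := (hf (e.symm u)).hasMFDerivAt.comp u h1.hasMFDerivAt
      have h3 : mfderiv 𝓘(ℝ, E) 𝓘(ℝ, ℝ) f (e.symm u) = 0 :=
        ContinuousLinearMap.ext fun v => hf0 (e.symm u) v
      rw [h3] at h2
      have h4 := hasMFDerivAt_iff_hasFDerivAt.mp h2
      convert! h4 using 1
    have hcont : ∀ᶠ q in 𝓝 p, q ∈ e.source ∧ e q ∈ Metric.ball (e p) r :=
      (e.open_source.eventually_mem hpe).and
        ((e.continuousAt hpe).eventually (Metric.ball_mem_nhds _ hr))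
    filter_upwards [hcont] with q ⟨hq, hqB⟩
    have h := Metric.isOpen_ball.is_const_of_fderiv_eq_zero (𝕜 := ℝ)
      (convex_ball (e p) r).isPreconnected
      (fun u hu => (hder u hu).differentiableAt.differentiableWithinAt)
      (fun u hu => (hder u hu).fderiv) hqB (Metric.mem_ball_self hr)
    simpa [e.left_inv hq, e.left_inv hpe] using h
  obtain ⟨p₀⟩ := (inferInstance : Nonempty M)
  exact ⟨f p₀, fun p => hloc.apply_eq_of_isPreconnected isPreconnected_univ trivial trivial⟩

end Constancy

/-! ### Nearly Kähler manifolds -/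

section NearlyKahler

variable {E : Type*} [NormedAddCommGroup E] [NormedSpace ℝ E] [FiniteDimensional ℝ E]
  {H : Type*} [TopologicalSpace H] {I : ModelWithCorners ℝ E H}
  {M : Type*} [TopologicalSpace M] [ChartedSpace H M] [IsManifold I ∞ M]
  [RiemannianBundle (fun x : M => TangentSpace I x)]
  [IsContMDiffRiemannianBundle I ∞ E (fun x : M => TangentSpace I x)]

variable {X Y : Π x : M, TangentSpace I x} {p : M}

namespace AlmostHermitianStructure

variable (S : AlmostHermitianStructure I M)

theorem isOrthogonalComplex (p : M) : IsOrthogonalComplex (S.J p) :=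
  ⟨S.J_J p, S.inner_J_J p⟩

theorem contMDiffAt_J (hX : CMDiffAt ∞ (T% X) p) :
    CMDiffAt ∞ (T% (fun q => S.J q (X q))) p :=
  ContMDiffAt.clm_bundle_apply (b := fun q : M => q) (S.contMDiff_J p) hX

theorem nabla_J_self (hS : S.IsNearlyKahler) (hX : CMDiffAt ∞ (T% X) p) :
    nabla I X (fun q => S.J q (X q)) p = S.J p (nabla I X X p) :=
  sub_eq_zero.mp (hS X p hX)

theorem hasConstantAntiholomorphic {ν : M → ℝ}
    (hν : S.HasPointwiseConstantAntiholomorphicCurvature ν) (p : M) :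
    HasConstantAntiholomorphic (S.J p) (curvature I p) (ν p) := by
  intro x y hxy
  have hT := isCurvatureLike_curvature (I := I) p
  have hJ := S.isOrthogonalComplex p
  by_cases hx : x = 0
  · subst hx
    have h := hT.smul_first 0 0 y y 0
    rw [zero_smul] at h
    rw [h, inner_zero_left]; ring
  by_cases hy : y = 0
  · subst hy
    have h := hT.smul_second 0 x 0 0 x
    rw [zero_smul] at h
    rw [h, inner_zero_left (𝕜 := ℝ) (0 : TangentSpace I p)]; ring
  have hx' : ‖x‖ ≠ 0 := norm_ne_zero_iff.mpr hx
  have hy' : ‖y‖ ≠ 0 := norm_ne_zero_iff.mpr hy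
  set x₁ := (‖x‖⁻¹ : ℝ) • x with hx₁
  set y₁ := (‖y‖⁻¹ : ℝ) • y with hy₁
  have hxy₁ : IsTotallyReal (S.J p) x₁ y₁ := (hxy.smul_left _).smul_right _
  have nx : ‖x₁‖ = 1 := by simp [hx₁, norm_smul, hx']
  have ny : ‖y₁‖ = 1 := by simp [hy₁, norm_smul, hy']
  have hon := orthonormal_pair nx ny hxy₁.1
  have hanti : S.IsAntiholomorphic p (Submodule.span ℝ {x₁, y₁}) := by
    constructor
    · have := finrank_span_eq_card hon.linearIndependent
      rwa [Matrix.range_cons_cons_empty, Fintype.card_fin] at this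
    · intro a ha b hb
      obtain ⟨s, t, rfl⟩ := Submodule.mem_span_pair.mp ha
      obtain ⟨s', t', rfl⟩ := Submodule.mem_span_pair.mp hb
      simp [inner_add_left, inner_add_right, real_inner_smul_left, real_inner_smul_right,
        hJ.inner_self, hxy₁.2, (hJ.symm hxy₁).2]
  have h := hν p _ hanti x₁ (Submodule.subset_span (by simp)) y₁ (Submodule.subset_span (by simp))
    nx ny hxy₁.1
  rw [hx₁, hy₁] at h
  simp only [hT.smul_first, hT.smul_second, hT.smul_third, hT.smul_fourth] at h
  rw [real_inner_self_eq_norm_sq, real_inner_self_eq_norm_sq, ← h]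
  field_simp

end AlmostHermitianStructure

/-- A totally real orthonormal triple extends to smooth local fields that form a totally real
orthonormal triple at every nearby point. -/
theorem exists_totallyReal_fields (S : AlmostHermitianStructure I M) {w x y : TangentSpace I p}
    (hw : ‖w‖ = 1) (hx : ‖x‖ = 1) (hy : ‖y‖ = 1) (hwx : IsTotallyReal (S.J p) w x)
    (hwy : IsTotallyReal (S.J p) w y) (hxy : IsTotallyReal (S.J p) x y) :
    ∃ W X Y : Π q : M, TangentSpace I q, W p = w ∧ X p = x ∧ Y p = y ∧
      ∀ᶠ q in 𝓝 p, CMDiffAt ∞ (T% W) q ∧ CMDiffAt ∞ (T% X) q ∧ CMDiffAt ∞ (T% Y) q ∧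
        ‖W q‖ = 1 ∧ ‖X q‖ = 1 ∧ ‖Y q‖ = 1 ∧ IsTotallyReal (S.J q) (W q) (X q) ∧
        IsTotallyReal (S.J q) (W q) (Y q) ∧ IsTotallyReal (S.J q) (X q) (Y q) := by
  obtain ⟨W, hWp, hWs, hW1, -⟩ := exists_unit_field (I := I) (p := p)
    (fun i : Fin 0 => i.elim0) (fun i => i.elim0)
    (.of_forall fun q => ⟨fun i => i.elim0, fun i => i.elim0⟩) w hw (fun i => i.elim0)
  have hJW : ∀ᶠ q in 𝓝 p, CMDiffAt ∞ (T% (fun q => S.J q (W q))) q :=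
    hWs.mono fun q h => S.contMDiffAt_J h
  obtain ⟨X, hXp, hXs, hX1, hXo⟩ := exists_unit_field (I := I) (p := p)
    ![W, fun q => S.J q (W q)] (fun i => by fin_cases i <;> [exact hWs; exact hJW])
    (hW1.mono fun q h => by
      convert! orthonormal_map_pair (S.isOrthogonalComplex q) h using 1
      funext i
      fin_cases i <;> rfl) x hx (fun i => by
        fin_cases i
        · exact (congrArg (fun a => (inner ℝ a x : ℝ)) hWp).trans hwx.1
        · exact (congrArg (fun a => (inner ℝ (S.J p a) x : ℝ)) hWp).trans hwx.2)
  have hJX : ∀ᶠ q in 𝓝 p, CMDiffAt ∞ (T% (fun q => S.J q (X q))) q :=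
    hXs.mono fun q h => S.contMDiffAt_J h
  have hWX : ∀ᶠ q in 𝓝 p, IsTotallyReal (S.J q) (W q) (X q) := by
    filter_upwards [hXo 0, hXo 1] with q h0 h1
    exact ⟨h0, h1⟩
  obtain ⟨Y, hYp, hYs, hY1, hYo⟩ := exists_unit_field (I := I) (p := p)
    ![W, fun q => S.J q (W q), X, fun q => S.J q (X q)]
    (fun i => by fin_cases i <;> [exact hWs; exact hJW; exact hXs; exact hJX])
    (by
      filter_upwards [hW1, hX1, hWX] with q h1 h2 h3
      convert! orthonormal_map_pairs (S.isOrthogonalComplex q) h1 h2 h3 using 1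
      funext i
      fin_cases i <;> rfl) y hy (fun i => by
        fin_cases i
        · exact (congrArg (fun a => (inner ℝ a y : ℝ)) hWp).trans hwy.1
        · exact (congrArg (fun a => (inner ℝ (S.J p a) y : ℝ)) hWp).trans hwy.2
        · exact (congrArg (fun a => (inner ℝ a y : ℝ)) hXp).trans hxy.1
        · exact (congrArg (fun a => (inner ℝ (S.J p a) y : ℝ)) hXp).trans hxy.2)
  refine ⟨W, X, Y, hWp, hXp, hYp, ?_⟩
  filter_upwards [hWs, hXs, hYs, hW1, hX1, hY1, hWX, hYo 0, hYo 1, hYo 2, hYo 3]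
    with q h1 h2 h3 h4 h5 h6 h7 h8 h9 h10 h11
  exact ⟨h1, h2, h3, h4, h5, h6, h7, ⟨h8, h9⟩, ⟨h10, h11⟩⟩

/-- Differentiating an inner product that is constant near `p`. -/
theorem inner_nabla_add_eq_zero {X Y Z : Π x : M, TangentSpace I x} {c : ℝ}
    (hX : CMDiffAt ∞ (T% X) p) (hY : CMDiffAt ∞ (T% Y) p) (hZ : CMDiffAt ∞ (T% Z) p)
    (h : ∀ᶠ q in 𝓝 p, inner ℝ (Y q) (Z q) = c) :
    inner ℝ (nabla I X Y p) (Z p) + inner ℝ (nabla I X Z p) (Y p) = (0 : ℝ) := by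
  have h1 := mvfderiv_inner (mdifferentiableAt_of_contMDiffAt hX)
    (mdifferentiableAt_of_contMDiffAt hY) (mdifferentiableAt_of_contMDiffAt hZ)
  have h2 : d% (fun q => (inner ℝ (Y q) (Z q) : ℝ)) p = d% (fun _ : M => c) p := mvfderiv_congr h
  rw [h2, mvfderiv_const] at h1
  rw [real_inner_comm (Y p), ← h1]
  rfl

/-- The differential of `ν` vanishes on `w` when `w`, `x`, `y` is a totally real orthonormal triple
with `R(Jy,y,y,x) = 0`: pair the second Bianchi identity for local fields `W`, `X`, `Y` extending
the triple, applied to `Y`, with `X`. -/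
theorem mvfderiv_eq_zero_of_triple (S : AlmostHermitianStructure I M) (hS : S.IsNearlyKahler)
    {ν : M → ℝ} (hν : S.HasPointwiseConstantAntiholomorphicCurvature ν)
    {w x y : TangentSpace I p}
    (hw : ‖w‖ = 1) (hx : ‖x‖ = 1) (hy : ‖y‖ = 1) (hwx : IsTotallyReal (S.J p) w x)
    (hwy : IsTotallyReal (S.J p) w y) (hxy : IsTotallyReal (S.J p) x y)
    (h0 : curvature I p (S.J p y) y y x = 0) :
    MDiffAt ν p ∧ d% ν p w = 0 := by
  obtain ⟨W, X, Y, rfl, rfl, rfl, hev⟩ := exists_totallyReal_fields S hw hx hy hwx hwy hxy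
  obtain ⟨sW, sX, sY, -⟩ := hev.self_of_nhds
  have md {A : Π x : M, TangentSpace I x} (h : CMDiffAt ∞ (T% A) p) : MDiffAt (T% A) p :=
    mdifferentiableAt_of_contMDiffAt h
  have one {q : M} {v : TangentSpace I q} (h : ‖v‖ = 1) : inner ℝ v v = (1 : ℝ) := by
    rw [real_inner_self_eq_norm_sq, h, one_pow]
  -- Near `p`, the components of the curvature entering the Bianchi identity are `ν`, `0`, `0`.
  have e1 : (fun q => (inner ℝ (curvatureField I X Y Y q) (X q) : ℝ)) =ᶠ[𝓝 p] ν := by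
    filter_upwards [hev] with q ⟨h1, h2, h3, h4, h5, h6, h7, h8, h9⟩
    rw [← curvature_apply h2 h3 h3, S.hasConstantAntiholomorphic hν q _ _ h9, one h5, one h6]
    ring
  have e2 : (fun q => (inner ℝ (curvatureField I Y W Y q) (X q) : ℝ)) =ᶠ[𝓝 p] fun _ => 0 := by
    filter_upwards [hev] with q ⟨h1, h2, h3, h4, h5, h6, h7, h8, h9⟩
    rw [← curvature_apply h3 h1 h3, (isCurvatureLike_curvature q).swap_first,
      curvature_outer (isCurvatureLike_curvature q) (S.hasConstantAntiholomorphic hν q) h8 h9,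
      h7.1]
    ring
  have e3 : (fun q => (inner ℝ (curvatureField I W X Y q) (X q) : ℝ)) =ᶠ[𝓝 p] fun _ => 0 := by
    filter_upwards [hev] with q ⟨h1, h2, h3, h4, h5, h6, h7, h8, h9⟩
    rw [← curvature_apply h1 h2 h3, (isCurvatureLike_curvature q).swap_last,
      curvature_outer (isCurvatureLike_curvature q) (S.hasConstantAntiholomorphic hν q) h7
        ((S.isOrthogonalComplex q).symm h9), h8.1]
    ring
  have s1 := contMDiffAt_curvatureField sX sY sY
  have s2 := contMDiffAt_curvatureField sY sW sY
  have s3 := contMDiffAt_curvatureField sW sX sY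
  have hd : MDiffAt ν p :=
    (mdifferentiableAt_inner (md s1) (md sX)).congr_of_eventuallyEq e1.symm
  refine ⟨hd, ?_⟩
  have f1 := mvfderiv_inner (md sW) (md s1) (md sX)
  have f2 := mvfderiv_inner (md sX) (md s2) (md sX)
  have f3 := mvfderiv_inner (md sY) (md s3) (md sX)
  rw [mvfderiv_congr e1, ← curvature_apply sX sY sY] at f1
  rw [mvfderiv_congr e2, mvfderiv_const, ← curvature_apply sY sW sY] at f2
  rw [mvfderiv_congr e3, mvfderiv_const, ← curvature_apply sW sX sY] at f3
  -- Derivatives of the orthogonality relations; the nearly Kähler condition enters in `r5` and `r6`.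
  have sJX := S.contMDiffAt_J sX
  have sJY := S.contMDiffAt_J sY
  have r1 := inner_nabla_add_eq_zero (c := 1) sW sX sX
    (hev.mono fun q ⟨h1, h2, h3, h4, h5, h6, h7, h8, h9⟩ => one h5)
  have r2 := inner_nabla_add_eq_zero (c := 1) sW sY sY
    (hev.mono fun q ⟨h1, h2, h3, h4, h5, h6, h7, h8, h9⟩ => one h6)
  have r3 := inner_nabla_add_eq_zero (c := 0) sX sX sW
    (hev.mono fun q ⟨h1, h2, h3, h4, h5, h6, h7, h8, h9⟩ =>
      ((S.isOrthogonalComplex q).symm h7).1)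
  have r4 := inner_nabla_add_eq_zero (c := 0) sY sY sW
    (hev.mono fun q ⟨h1, h2, h3, h4, h5, h6, h7, h8, h9⟩ =>
      ((S.isOrthogonalComplex q).symm h8).1)
  have r5 := inner_nabla_add_eq_zero (c := 0) sX sJX sY
    (hev.mono fun q ⟨h1, h2, h3, h4, h5, h6, h7, h8, h9⟩ => h9.2)
  have r6 := inner_nabla_add_eq_zero (c := 0) sY sJY sX
    (hev.mono fun q ⟨h1, h2, h3, h4, h5, h6, h7, h8, h9⟩ =>
      ((S.isOrthogonalComplex q).symm h9).2)
  rw [S.nabla_J_self hS sX, (S.isOrthogonalComplex p).inner_left] at r5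
  rw [S.nabla_J_self hS sY, (S.isOrthogonalComplex p).inner_left] at r6
  have key := bianchi_correction_eq_zero (S.isOrthogonalComplex p) (isCurvatureLike_curvature p)
    (S.hasConstantAntiholomorphic hν p) hwx hwy hxy (one hw) (one hx) (one hy) h0
    (wX := nabla I W X p) (wY := nabla I W Y p) (xX := nabla I X X p) (xY := nabla I X Y p)
    (xW := nabla I X W p) (yX := nabla I Y X p) (yY := nabla I Y Y p) (yW := nabla I Y W p)
    (by linarith) (by linarith) r3 r4 (by linarith) (by linarith)
  have hB := congrArg (fun v => (inner ℝ v (X p) : ℝ))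
    (curvatureField_second_bianchi sW sX sY sY)
  simp only [inner_add_left, inner_sub_left, inner_zero_left] at hB
  rw [← curvature_apply sX sY (contMDiffAt_nabla sW sY),
    ← curvature_apply sY sW (contMDiffAt_nabla sX sY),
    ← curvature_apply sW sX (contMDiffAt_nabla sY sY),
    ← curvature_apply sW (contMDiffAt_mlieBracket sX sY) sY,
    ← curvature_apply sX (contMDiffAt_mlieBracket sY sW) sY,
    ← curvature_apply sY (contMDiffAt_mlieBracket sW sX) sY,
    mlieBracket_eq_nabla_sub (md sX) (md sY), mlieBracket_eq_nabla_sub (md sY) (md sW),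
    mlieBracket_eq_nabla_sub (md sW) (md sX)] at hB
  simp only [_root_.zero_apply] at f2 f3
  linarith

theorem mvfderiv_eq_zero (S : AlmostHermitianStructure I M) (hdim : 6 ≤ finrank ℝ E)
    (hS : S.IsNearlyKahler) {ν : M → ℝ}
    (hν : S.HasPointwiseConstantAntiholomorphicCurvature ν) (p : M) :
    MDiffAt ν p ∧ ∀ v : TangentSpace I p, d% ν p v = 0 := by
  have hdim' : 6 ≤ finrank ℝ (TangentSpace I p) := hdim
  have key (w : TangentSpace I p) (hw : ‖w‖ = 1) : MDiffAt ν p ∧ d% ν p w = 0 := by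
    obtain ⟨x, y, hwx, hwy, hxy, hx, hy, h0⟩ := exists_totallyReal_triple hdim'
      (S.isOrthogonalComplex p) (isCurvatureLike_curvature p) w
    rw [real_inner_self_eq_norm_sq] at hx hy
    exact mvfderiv_eq_zero_of_triple S hS hν hw
      ((pow_eq_one_iff_of_nonneg (norm_nonneg x) two_ne_zero).mp hx)
      ((pow_eq_one_iff_of_nonneg (norm_nonneg y) two_ne_zero).mp hy) hwx hwy hxy h0
  have unit (v : TangentSpace I p) (hv : v ≠ 0) : ‖(‖v‖⁻¹ : ℝ) • v‖ = 1 := by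
    have : ‖v‖ ≠ 0 := norm_ne_zero_iff.mpr hv
    simp [norm_smul, this]
  have : Nontrivial (TangentSpace I p) := nontrivial_of_finrank_pos (R := ℝ) (by omega)
  obtain ⟨v₀, hv₀⟩ := exists_ne (0 : TangentSpace I p)
  refine ⟨(key _ (unit v₀ hv₀)).1, fun v => ?_⟩
  by_cases hv : v = 0
  · rw [hv, map_zero]
  · have h := (key _ (unit v hv)).2
    rw [map_smul, smul_eq_zero] at h
    exact h.resolve_left (inv_ne_zero (norm_ne_zero_iff.mpr hv))

end NearlyKahler

end AlmostHermitian

end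

theorem theorem2 {E : Type*} [NormedAddCommGroup E] [NormedSpace ℝ E] [FiniteDimensional ℝ E]
    {M : Type*} [TopologicalSpace M] [T2Space M] [ConnectedSpace M]
    [ChartedSpace E M] [IsManifold 𝓘(ℝ, E) ∞ M]
    [RiemannianBundle (fun x : M => TangentSpace 𝓘(ℝ, E) x)]
    [IsContMDiffRiemannianBundle 𝓘(ℝ, E) ∞ E (fun x : M => TangentSpace 𝓘(ℝ, E) x)]
    (n : ℕ) (hdim : finrank ℝ E = 2 * n) (hn : 4 < 2 * n)
    (S : AlmostHermitian.AlmostHermitianStructure 𝓘(ℝ, E) M) (hS : S.IsNearlyKahler)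
    (ν : M → ℝ) (hν : S.HasPointwiseConstantAntiholomorphicCurvature ν) :
    ∃ c : ℝ, ∀ p : M, ν p = c :=
  have h := AlmostHermitian.mvfderiv_eq_zero S (by omega) hS hν
  AlmostHermitian.exists_eq_const_of_mvfderiv_eq_zero (fun p => (h p).1) fun p => (h p).2
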